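/- **Elliptic functions.** Let $\operatorname{Im}\tau>0$, $\Lambda=\mathbb Z+\tau\mathbb Z$, $i=\sqrt{-1}$. Put $$\vartheta(z)=\sum_{n\in\mathbb Z}(-1)^n e^{\pi i\left((n+\frac12)^2\tau+(2n+1)z\right)},\quad E_1=\frac{\vartheta'}{\vartheta},\quad E_2=-E_1',\quad \phi(u,z)=\frac{\vartheta(u+z)\vartheta'(0)}{\vartheta(u)\vartheta(z)},\quad \phi'(u,z)=\partial_u\phi(u,z),$$ and let $\wp$ be the Weierstrass function with period lattice $\Lambda$. **Fields.** Let $\ell>0$, $h\in\mathbb C\setminus\{0\}$, and let $J\subset\mathbb R$ be an open set of times. Let $u(x,t),v(x,t)$ be smooth complex fields, $x\in\mathbb R$, $t\in J$, both $\ell$-periodic in $x$, and let $\nu(x,t)$ be a smooth complex field with $\nu^2=h-u_x^2$. Assume that $\nu$ vanishes nowhere and that $2u(x,t)\notin\Lambda$ for all $(x,t)$. Consider the Hamiltonian $$H_0^{CM}=\oint dx\left(-\frac{v^2}{16\pi^2}\Bigl(1-\frac{u_x^2}{h}\Bigr)+(3u_x^2-h)\wp(2u)-\frac{u_{xx}^2}{4(h-u_x^2)}\right)$$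 and the bracket $\{v(x),u(y)\}=\delta(x-y)$, so that the equations of motion are $u_t=\delta H_0^{CM}/\delta v$, $v_t=-\delta H_0^{CM}/\delta u$. **Claim.** (1) These equations of motion are equivalent to $$u_t=-\frac{v}{8\pi^2}\Bigl(1-\frac{u_x^2}{h}\Bigr),$$ $$v_t=\frac1{8\pi^2h}\partial_x(v^2u_x)-2(3u_x^2-h)\wp'(2u)+6\,\partial_x(u_x\wp(2u))+\frac12\partial_x\Bigl(\frac{u_{xxx}\nu-\nu_xu_{xx}}{\nu^3}\Bigr).$$ (2) They are equivalent to the Zakharov–Shabat equation $\partial_tL-\partial_xM+[M,L]=0$, required for all $z\in\mathbb C\setminus\Lambda$, with $$L=\begin{pmatrix}-\frac{v}{4\pi i}-u_xE_1(z)&\nu\phi(2u,z)\\ \nu\phi(-2u,z)&\frac{v}{4\pi i}+u_xE_1(z)\end{pmatrix}$$ and the traceless matrix $M$ ($M_{22}=-M_{11}$) given by $$M_{11}=-u_tE_1(z)-\frac1{4\pi i}\Bigl(\frac{v^2u_x}{8\pi^2h}+6u_x\wp(2u)+\frac{u_{xxx}\nu-\nu_xu_{xx}}{2\nu^3}\Bigr)+\frac{u_x}{2\pi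 i}\bigl(E_2(2u)-E_2(z)\bigr),$$ $$M_{12}=-\frac{\nu}{2\pi i}\phi'(2u,z)+\Bigl(\frac{\nu}{2\pi i}E_1(z)+\frac{vu_x\nu}{8\pi^2h}-\frac1{4\pi i}\frac{u_{xx}}{\nu}\Bigr)\phi(2u,z),$$ $$M_{21}=-\frac{\nu}{2\pi i}\phi'(-2u,z)+\Bigl(\frac{\nu}{2\pi i}E_1(z)+\frac{vu_x\nu}{8\pi^2h}+\frac1{4\pi i}\frac{u_{xx}}{\nu}\Bigr)\phi(-2u,z).$$ (3) If $u,v$ do not depend on $x$, then for every $\nu_0$ with $\nu_0^2=h$ the equations of motion are equivalent to the two-body elliptic Calogero–Moser system: $q=(u,-u)$, $p=\left(-\frac{v}{8\pi^2},\frac{v}{8\pi^2}\right)$ satisfy Hamilton's equations $\dot q_j=\partial H/\partial p_j$, $\dot p_j=-\partial H/\partial q_j$ for $$H=\tfrac12(p_1^2+p_2^2)+g^2\wp(q_1-q_2),\qquad g=\frac{\nu_0}{2\pi}.$$ -/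

import Mathlib

open scoped ContDiff Matrix
open Complex (I)

noncomputable section

namespace CalogeroMoser2D

/-! ### Elliptic functions on `ℂ / (ℤ + τ ℤ)` -/

/-- The periods `1, τ`. -/
def periods (τ : UpperHalfPlane) : PeriodPair where
  ω₁ := 1
  ω₂ := (τ : ℂ)
  indep := by
    rw [LinearIndependent.pair_iff]
    intro a b hab
    have him := congrArg Complex.im hab
    have hre := congrArg Complex.re hab
    simp at him hre
    have hb : b = 0 := by
      rcases him with h | h
      · exact h
      · exact absurd h τ.im_pos.ne'
    subst hb
    simpa using hre

/-- The lattice `Λ = ℤ + τ ℤ`. -/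
def Λ (τ : UpperHalfPlane) : Submodule ℤ ℂ := (periods τ).lattice

/-- The odd theta function
`ϑ(z) = ∑ₙ (-1)ⁿ exp (π i ((n + 1/2)² τ + (2 n + 1) z))`; see `hasSum_theta`. -/
def theta (τ : UpperHalfPlane) (z : ℂ) : ℂ :=
  Complex.exp (Real.pi * I * (τ / 4 + z)) * jacobiTheta₂ (z + (1 + τ) / 2) τ

theorem hasSum_theta (τ : UpperHalfPlane) (z : ℂ) :
    HasSum (fun n : ℤ => (-1 : ℂ) ^ n *
      Complex.exp (Real.pi * I * (((n : ℂ) + 1 / 2) ^ 2 * τ + (2 * n + 1) * z)))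
      (theta τ z) := by
  have h := (hasSum_jacobiTheta₂_term (z + (1 + τ) / 2) τ.im_pos).mul_left
    (Complex.exp (Real.pi * I * (τ / 4 + z)))
  refine h.congr_fun ?_
  intro n
  have h1 : (-1 : ℂ) ^ n = Complex.exp (n * (Real.pi * I)) := by
    rw [Complex.exp_int_mul, Complex.exp_pi_mul_I]
  rw [jacobiTheta₂_term, h1, ← Complex.exp_add, ← Complex.exp_add]
  congr 1
  ring

/-- The Eisenstein function `E₁ = ∂ log ϑ`. -/
def E₁ (τ : UpperHalfPlane) (z : ℂ) : ℂ := deriv (theta τ) z / theta τ z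

/-- The Eisenstein function `E₂ = - ∂ E₁`. -/
def E₂ (τ : UpperHalfPlane) (z : ℂ) : ℂ := -deriv (E₁ τ) z

/-- The Weierstrass function `℘(z) = ℘(z|τ)` with periods `1, τ`. -/
def wp (τ : UpperHalfPlane) (z : ℂ) : ℂ := (periods τ).weierstrassP z

/-- The derivative `℘'(z)`. -/
def wp' (τ : UpperHalfPlane) (z : ℂ) : ℂ := deriv (wp τ) z

/-- `φ(u, z) = ϑ(u + z) ϑ'(0) / (ϑ(u) ϑ(z))`. -/
def phi (τ : UpperHalfPlane) (u z : ℂ) : ℂ :=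
  theta τ (u + z) * deriv (theta τ) 0 / (theta τ u * theta τ z)

/-- `φ'(u, z) = ∂φ(u, z)/∂u`. -/
def phi' (τ : UpperHalfPlane) (u z : ℂ) : ℂ := deriv (fun w => phi τ w z) u

/-! ### Fields -/

/-- `∂f/∂x` of a field `f(x, t)`. -/
def dX (f : ℝ → ℝ → ℂ) : ℝ → ℝ → ℂ := fun x t => deriv (fun y => f y t) x

/-- `∂f/∂t` of a field `f(x, t)`. -/
def dT (f : ℝ → ℝ → ℂ) : ℝ → ℝ → ℂ := fun x t => deriv (fun s => f x s) t

/-- Entrywise `∂/∂x` of a matrix field. -/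
def dXMat (A : ℝ → ℝ → Matrix (Fin 2) (Fin 2) ℂ) (x t : ℝ) : Matrix (Fin 2) (Fin 2) ℂ :=
  Matrix.of fun i j => dX (fun y s => A y s i j) x t

/-- Entrywise `∂/∂t` of a matrix field. -/
def dTMat (A : ℝ → ℝ → Matrix (Fin 2) (Fin 2) ℂ) (x t : ℝ) : Matrix (Fin 2) (Fin 2) ℂ :=
  Matrix.of fun i j => dT (fun y s => A y s i j) x t

/-- `f(x, t)` is smooth for `x ∈ ℝ` and `t ∈ J`. -/
def SmoothField (J : Set ℝ) (f : ℝ → ℝ → ℂ) : Prop :=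
  ContDiffOn ℝ ∞ (Function.uncurry f) (Set.univ ×ˢ J)

/-- Smooth complex functions on the circle `ℝ / ℓ ℤ`. -/
def IsLoop (ℓ : ℝ) (w : ℝ → ℂ) : Prop :=
  ContDiff ℝ ∞ w ∧ Function.Periodic w ℓ

/-! ### Hamiltonian dynamics on the circle -/

/-- `g` is the variational derivative `δH/δa` at the loop `a`: for every smooth loop `w`,
`d/ds H[a + s w] = ∮ g w dx` at `s = 0`. -/
def HasVariationalDeriv (ℓ : ℝ) (H : (ℝ → ℂ) → ℂ) (g a : ℝ → ℂ) : Prop :=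
  ∀ w : ℝ → ℂ, IsLoop ℓ w →
    HasDerivAt (fun s : ℂ => H (fun x => a x + s * w x)) (∫ x in (0 : ℝ)..ℓ, g x * w x) 0

/-- The quadratic Hamiltonian
`H₀[u, v] = ∮ dx (-v²/(16π²) (1 - uₓ²/h) + (3uₓ² - h) ℘(2u) - uₓₓ²/(4(h - uₓ²)))`. -/
def H₀ (τ : UpperHalfPlane) (ℓ : ℝ) (h : ℂ) (a b : ℝ → ℂ) : ℂ :=
  ∫ x in (0 : ℝ)..ℓ,
    (-(b x) ^ 2 / (16 * (Real.pi : ℂ) ^ 2) * (1 - (deriv a x) ^ 2 / h)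
      + (3 * (deriv a x) ^ 2 - h) * wp τ (2 * a x)
      - (deriv (deriv a) x) ^ 2 / (4 * (h - (deriv a x) ^ 2)))

/-- The equations of motion `u_t = δH₀/δv`, `v_t = -δH₀/δu` generated by `H₀` through the
canonical bracket `{v(x), u(y)} = δ(x - y)`. -/
def IsHamiltonianFlow (τ : UpperHalfPlane) (ℓ : ℝ) (h : ℂ) (J : Set ℝ) (u v : ℝ → ℝ → ℂ) :
    Prop :=
  ∀ t ∈ J,
    HasVariationalDeriv ℓ (fun b => H₀ τ ℓ h (fun x => u x t) b)
      (fun x => dT u x t) (fun x => v x t) ∧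
    HasVariationalDeriv ℓ (fun a => H₀ τ ℓ h a (fun x => v x t))
      (fun x => -dT v x t) (fun x => u x t)

/-- The equations of motion written out. -/
def IsFieldSolution (τ : UpperHalfPlane) (h : ℂ) (J : Set ℝ) (u v ν : ℝ → ℝ → ℂ) : Prop :=
  ∀ x : ℝ, ∀ t ∈ J,
    dT u x t = -(v x t) / (8 * (Real.pi : ℂ) ^ 2) * (1 - (dX u x t) ^ 2 / h) ∧
    dT v x t =
      1 / (8 * (Real.pi : ℂ) ^ 2 * h) * dX (fun y s => (v y s) ^ 2 * dX u y s) x t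
      - 2 * (3 * (dX u x t) ^ 2 - h) * wp' τ (2 * u x t)
      + 6 * dX (fun y s => dX u y s * wp τ (2 * u y s)) x t
      + 1 / 2 * dX (fun y s =>
          (dX (dX (dX u)) y s * ν y s - dX ν y s * dX (dX u) y s) / (ν y s) ^ 3) x t

/-! ### The L-M pair -/

/-- The `L` matrix. -/
def Lmat (τ : UpperHalfPlane) (u v ν : ℝ → ℝ → ℂ) (z : ℂ) (x t : ℝ) :
    Matrix (Fin 2) (Fin 2) ℂ :=
  !![-(1 / (4 * Real.pi * I)) * v x t - dX u x t * E₁ τ z, ν x t * phi τ (2 * u x t) z;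
     ν x t * phi τ (-2 * u x t) z, 1 / (4 * Real.pi * I) * v x t + dX u x t * E₁ τ z]

def M₁₁ (τ : UpperHalfPlane) (h : ℂ) (u v ν : ℝ → ℝ → ℂ) (z : ℂ) (x t : ℝ) : ℂ :=
  -(dT u x t) * E₁ τ z
    - 1 / (4 * Real.pi * I) *
      (1 / (8 * (Real.pi : ℂ) ^ 2 * h) * (v x t) ^ 2 * dX u x t
        + 6 * dX u x t * wp τ (2 * u x t)
        + (dX (dX (dX u)) x t * ν x t - dX ν x t * dX (dX u) x t) / (2 * (ν x t) ^ 3))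
    + dX u x t / (2 * Real.pi * I) * (E₂ τ (2 * u x t) - E₂ τ z)

def M₁₂ (τ : UpperHalfPlane) (h : ℂ) (u v ν : ℝ → ℝ → ℂ) (z : ℂ) (x t : ℝ) : ℂ :=
  -(ν x t / (2 * Real.pi * I)) * phi' τ (2 * u x t) z
    + (ν x t / (2 * Real.pi * I) * E₁ τ z
        + v x t * dX u x t * ν x t / (8 * (Real.pi : ℂ) ^ 2 * h)
        - 1 / (4 * Real.pi * I) * (dX (dX u) x t / ν x t)) * phi τ (2 * u x t) z

def M₂₁ (τ : UpperHalfPlane) (h : ℂ) (u v ν : ℝ → ℝ → ℂ) (z : ℂ) (x t : ℝ) : ℂ :=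
  -(ν x t / (2 * Real.pi * I)) * phi' τ (-2 * u x t) z
    + (ν x t / (2 * Real.pi * I) * E₁ τ z
        + v x t * dX u x t * ν x t / (8 * (Real.pi : ℂ) ^ 2 * h)
        + 1 / (4 * Real.pi * I) * (dX (dX u) x t / ν x t)) * phi τ (-2 * u x t) z

/-- The (traceless) `M` matrix. -/
def Mmat (τ : UpperHalfPlane) (h : ℂ) (u v ν : ℝ → ℝ → ℂ) (z : ℂ) (x t : ℝ) :
    Matrix (Fin 2) (Fin 2) ℂ :=
  !![M₁₁ τ h u v ν z x t, M₁₂ τ h u v ν z x t;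
     M₂₁ τ h u v ν z x t, -(M₁₁ τ h u v ν z x t)]

/-- The Zakharov–Shabat equation `∂ₜL - ∂ₓM + [M, L] = 0`, for all values of the spectral
parameter `z` off the lattice. -/
def ZakharovShabat (τ : UpperHalfPlane) (h : ℂ) (J : Set ℝ) (u v ν : ℝ → ℝ → ℂ) : Prop :=
  ∀ x : ℝ, ∀ t ∈ J, ∀ z : ℂ, z ∉ Λ τ →
    dTMat (Lmat τ u v ν z) x t - dXMat (Mmat τ h u v ν z) x t
      + (Mmat τ h u v ν z x t * Lmat τ u v ν z x t
        - Lmat τ u v ν z x t * Mmat τ h u v ν z x t) = 0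

/-! ### The finite-dimensional elliptic Calogero–Moser system -/

/-- The `N`-body Hamiltonian `H₂(p, q) = ½ ∑ⱼ pⱼ² + g² ∑_{j > k} ℘(qⱼ - qₖ)`. -/
def cmHamiltonian (τ : UpperHalfPlane) (N : ℕ) (g : ℂ) (p q : Fin N → ℂ) : ℂ :=
  1 / 2 * ∑ j, (p j) ^ 2 + g ^ 2 * ∑ j, ∑ k with k < j, wp τ (q j - q k)

/-- The trajectory `(p(t), q(t))`, `t ∈ J`, lies in the phase space `∑ⱼ pⱼ = ∑ⱼ qⱼ = 0` and
satisfies Hamilton's equations `q̇ⱼ = ∂H₂/∂pⱼ`, `ṗⱼ = -∂H₂/∂qⱼ`. -/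
def IsCMSolution (τ : UpperHalfPlane) (N : ℕ) (g : ℂ) (J : Set ℝ) (p q : ℝ → Fin N → ℂ) :
    Prop :=
  ∀ t ∈ J, ∑ j, p t j = 0 ∧ ∑ j, q t j = 0 ∧ ∀ j,
    HasDerivAt (fun y => cmHamiltonian τ N g (Function.update (p t) j y) (q t))
      (deriv (fun s => q s j) t) (p t j) ∧
    HasDerivAt (fun y => cmHamiltonian τ N g (p t) (Function.update (q t) j y))
      (-deriv (fun s => p s j) t) (q t j)

end CalogeroMoser2D

end

open scoped ContDiff Matrix
open Complex (I)

noncomputable section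

namespace CalogeroMoser2D

/-! Every formulation is compared with the vanishing of two functions, `defectU` and `defectV`,
which measure the failure of the explicit equations of motion. The Hamiltonian flow, the
Zakharov–Shabat equation and (for fields constant in x) the Calogero–Moser system are each
equivalent to both defects being zero everywhere.

Zakharov–Shabat: the curvature ∂ₜL - ∂ₓM + [M, L] is computed without imposing any equation of
motion (`zakharovShabat_eq`). Its diagonal is a nonzero multiple of `defectV`; its off-diagonal
entries are linear in `defectU` and ∂ₓ`defectU`. At z = -2u(x,t) the factor φ(2u,z) vanishes while
φ'(2u,z) does not, which isolates `defectU`. The computation needs φ(u,z)φ(-u,z) = ℘(z) - ℘(u), its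
u-derivative, the Lamé equation for φ in u, and the constancy of E₂ - ℘.

These elliptic facts come from the addition theorem `theta_addition`, which rests on a dimension
count: ϑ(z+w)ϑ(z-w), ϑ² and ϑ²℘ are theta functions of order 2, and the recursion of their Fourier
coefficients leaves only two free. The same count locates the zeros of ϑ. Logarithmic
differentiation gives the addition formula for E₁, one more derivative gives that for E₂, and the
cubic relation for ℘' then yields E₂ - ℘ = const and the Lamé equation.

Hamiltonian flow: H₀ is differentiated under the integral sign and integrated by parts on the
circle; a smooth periodic variational derivative is unique.

Calogero–Moser: for fields constant in x the flux vanishes and the equations become u_t = -v/(8π²),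
v_t = 2h℘'(2u), which are Hamilton's equations with g² = h/(4π²). -/

open Topology Filter Set in
/-- Differentiation under an interval integral, for an integrand that is continuous together with
its derivative near the segment of integration. -/
theorem hasDerivAt_intervalIntegral_of_continuousOn {F F' : ℂ → ℝ → ℂ} {a b : ℝ} {s₀ : ℂ}
    {U : Set (ℂ × ℝ)} (hU : IsOpen U) (hsub : ∀ x ∈ uIcc a b, (s₀, x) ∈ U)
    (hF : ContinuousOn (Function.uncurry F) U) (hF' : ContinuousOn (Function.uncurry F') U)
    (hd : ∀ s x, (s, x) ∈ U → HasDerivAt (fun s => F s x) (F' s x) s) :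
    HasDerivAt (fun s => ∫ x in a..b, F s x) (∫ x in a..b, F' s₀ x) s₀ := by
  -- By the tube lemma, U contains a closed ball about s₀ times the segment. This product is
  -- compact, so `F'` is bounded on it by a constant, which serves as the dominating function.
  obtain ⟨V, W, hV, -, hsV, htW, hVW⟩ := generalized_tube_lemma (isCompact_singleton (x := s₀))
    (isCompact_uIcc (a := a) (b := b)) hU (by rintro ⟨s, x⟩ ⟨rfl, hx⟩; exact hsub x hx)
  obtain ⟨r, hr, hrV⟩ := Metric.nhds_basis_closedBall.mem_iff.1 (hV.mem_nhds (hsV rfl))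
  have hBU : Metric.closedBall s₀ r ×ˢ uIcc a b ⊆ U := (prod_mono hrV htW).trans hVW
  obtain ⟨C, hC⟩ := ((isCompact_closedBall s₀ r).prod (isCompact_uIcc (a := a)
    (b := b))).exists_bound_of_continuousOn (hF'.mono hBU)
  have hcont : ∀ {G : ℂ → ℝ → ℂ}, ContinuousOn (Function.uncurry G) U → ∀ s ∈ Metric.closedBall s₀ r,
      ContinuousOn (G s) (uIcc a b) := fun hG s hs =>
    (hG.mono hBU).comp (by fun_prop : ContinuousOn (fun x : ℝ => (s, x)) (uIcc a b))
      (fun x hx => ⟨hs, hx⟩)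
  have hmeas : ∀ {G : ℂ → ℝ → ℂ}, ContinuousOn (Function.uncurry G) U → ∀ s ∈ Metric.closedBall s₀ r,
      MeasureTheory.AEStronglyMeasurable (G s) (MeasureTheory.volume.restrict (uIoc a b)) :=
    fun hG s hs => ((hcont hG s hs).mono uIoc_subset_uIcc).aestronglyMeasurable measurableSet_uIoc
  refine (intervalIntegral.hasDerivAt_integral_of_dominated_loc_of_deriv_le (bound := fun _ => C)
    (Metric.closedBall_mem_nhds s₀ hr) ?_ ?_ ?_ ?_ ?_ ?_).2
  · filter_upwards [Metric.closedBall_mem_nhds s₀ hr] with s hs using hmeas hF s hs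
  · exact (hcont hF s₀ (Metric.mem_closedBall_self hr.le)).intervalIntegrable
  · exact hmeas hF' s₀ (Metric.mem_closedBall_self hr.le)
  · exact .of_forall fun x hx s hs => hC (s, x) ⟨hs, uIoc_subset_uIcc hx⟩
  · simp
  · exact .of_forall fun x hx s hs => hd s x (hBU ⟨hs, uIoc_subset_uIcc hx⟩)

/-! ### Fourier coefficients of periodic entire functions; theta functions of order 2 -/

/-- The integral of an entire function of period `1` over a period does not depend on the
starting point. -/
theorem integral_add_of_periodic {g : ℂ → ℂ} (hg : Differentiable ℂ g)
    (hper : ∀ z, g (z + 1) = g z) (c : ℂ) :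
    ∫ x in (0 : ℝ)..1, g (x + c) = ∫ x in (0 : ℝ)..1, g x := by
  have hg' : Continuous (deriv g) := (hg.contDiff (n := 1)).continuous_deriv le_rfl
  have hd : ∀ c, HasDerivAt (fun c : ℂ => ∫ x in (0 : ℝ)..1, g (x + c)) 0 c := by
    intro c
    have h := hasDerivAt_intervalIntegral_of_continuousOn (a := 0) (b := 1) (s₀ := c)
      (F := fun c x => g (x + c)) (F' := fun c x => deriv g (x + c)) isOpen_univ
      (by simp) (by have := hg.continuous; simp only [Function.uncurry_def]; fun_prop)
      (by simp only [Function.uncurry_def]; fun_prop)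
      (fun s x _ => by simpa using (hg (x + s)).hasDerivAt.comp_const_add (x : ℂ) s)
    -- The derivative in c is ∫ g'(x + c) dx = g(1 + c) - g(c) = 0.
    convert h using 1
    have hftc := intervalIntegral.integral_eq_sub_of_hasDerivAt (a := 0) (b := 1)
      (f := fun x : ℝ => g (x + c)) (f' := fun x => deriv g (x + c))
      (fun x _ => by
        have := (hg (x + c)).hasDerivAt.comp_add_const (x : ℂ) c
        exact this.comp_ofReal)
      (by apply Continuous.intervalIntegrable; fun_prop)
    rw [hftc]
    have := hper c
    push_cast
    rw [add_comm 1 c, this]; simp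
  have := is_const_of_deriv_eq_zero (f := fun c : ℂ => ∫ x in (0 : ℝ)..1, g (x + c))
    (fun c => (hd c).differentiableAt) (fun c => (hd c).deriv) c 0
  simpa using this

/-- The Fourier coefficients of a function of period `1`. -/
def fcoef (f : ℂ → ℂ) (n : ℤ) : ℂ :=
  ∫ x in (0 : ℝ)..1, f x * Complex.exp (-(2 * Real.pi * I * n * x))

theorem exp_periodic (n : ℤ) (z : ℂ) :
    Complex.exp (-(2 * Real.pi * I * n * (z + 1))) = Complex.exp (-(2 * Real.pi * I * n * z)) := by
  rw [show -(2 * Real.pi * I * n * (z + 1)) = -(2 * Real.pi * I * n * z)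
    + ((-n : ℤ) : ℂ) * (2 * Real.pi * I) by push_cast; ring, Complex.exp_add,
    Complex.exp_int_mul_two_pi_mul_I, mul_one]

theorem fcoef_comp_add {f : ℂ → ℂ} (hf : Differentiable ℂ f) (hper : ∀ z, f (z + 1) = f z)
    (c : ℂ) (n : ℤ) :
    fcoef (fun z => f (z + c)) n = Complex.exp (2 * Real.pi * I * n * c) * fcoef f n := by
  have h := integral_add_of_periodic (g := fun z => f z * Complex.exp (-(2 * Real.pi * I * n * z)))
    (by fun_prop) (fun z => by simp only [hper, exp_periodic]) c
  rw [fcoef, fcoef, ← h, ← intervalIntegral.integral_const_mul]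
  congr 1; ext x
  rw [mul_left_comm, ← Complex.exp_add]
  congr 2; ring

/-- Translation by z multiplies each Fourier coefficient by a nonzero factor, so it suffices to
treat the point 0. On the real circle the Fourier series is then identically zero, hence summable,
hence converges pointwise to the function. -/
theorem eq_zero_of_fcoef_eq_zero {f : ℂ → ℂ} (hf : Differentiable ℂ f)
    (hper : ∀ z, f (z + 1) = f z) (h : ∀ n, fcoef f n = 0) (z : ℂ) : f z = 0 := by
  have key : ∀ g : ℂ → ℂ, Differentiable ℂ g → (∀ z, g (z + 1) = g z) → (∀ n, fcoef g n = 0) →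
      g 0 = 0 := by
    intro g hg hgper hgc
    have hper' : Function.Periodic (fun x : ℝ => g x) 1 := fun x => by
      simpa using hgper x
    have hc : Continuous (hper'.lift : AddCircle (1 : ℝ) → ℂ) := by
      have := hg.continuous
      exact continuous_coinduced_dom.mpr (by
        change Continuous (fun x : ℝ => g x); fun_prop)
    let G : C(AddCircle (1 : ℝ), ℂ) := ⟨hper'.lift, hc⟩
    have hcoef : ∀ n, fourierCoeff G n = 0 := by
      intro n
      rw [fourierCoeff_eq_intervalIntegral _ _ 0]
      have := hgc n
      simp only [fcoef] at this
      simp only [zero_add, div_one, one_smul, smul_eq_mul]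
      rw [← this]
      congr 1; ext x
      rw [fourier_coe_apply, mul_comm]
      change g x * _ = _
      congr 2; push_cast; ring
    have hcoef' : fourierCoeff (G : AddCircle (1 : ℝ) → ℂ) = 0 := funext hcoef
    have hs := has_pointwise_sum_fourier_series_of_summable (f := G)
      (by rw [hcoef']; exact summable_zero) ((0 : ℝ) : AddCircle (1 : ℝ))
    have hz : (fun i => fourierCoeff G i • fourier i ((0 : ℝ) : AddCircle (1 : ℝ))) = fun _ => 0 :=
      funext fun i => by rw [hcoef, zero_smul]
    have := (hz ▸ hs).unique hasSum_zero
    change g ((0 : ℝ) : ℂ) = 0 at this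
    simpa using this
  have := key (fun w => f (w + z)) (by fun_prop) (fun w => by
    rw [← hper (w + z)]; ring_nf) (fun n => by rw [fcoef_comp_add hf hper, h, mul_zero])
  simpa using this

/-- The space of theta functions of order `2`. -/
structure IsTheta₂ (τ : UpperHalfPlane) (f : ℂ → ℂ) : Prop where
  differentiable : Differentiable ℂ f
  add_one : ∀ z, f (z + 1) = f z
  add_tau : ∀ z, f (z + τ) = Complex.exp (-(2 * Real.pi * I * (τ + 2 * z))) * f z

/-- The n-th coefficient of f(z + τ) is computed in two ways: shifting the path gives e^{2πinτ} cₙ,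
while the multiplier, through its factor e^{-4πiz}, gives e^{-2πiτ} cₙ₊₂. -/
theorem IsTheta₂.fcoef_add_two {τ : UpperHalfPlane} {f : ℂ → ℂ} (hf : IsTheta₂ τ f) (n : ℤ) :
    fcoef f n = 0 ↔ fcoef f (n + 2) = 0 := by
  have h := fcoef_comp_add hf.differentiable hf.add_one τ n
  have h2 : fcoef (fun z => f (z + τ)) n
      = Complex.exp (-(2 * Real.pi * I * τ)) * fcoef f (n + 2) := by
    rw [fcoef, fcoef, ← intervalIntegral.integral_const_mul]
    congr 1; ext x
    rw [hf.add_tau, mul_right_comm, ← Complex.exp_add, mul_comm (f x), ← mul_assoc,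
      ← Complex.exp_add]
    congr 2; push_cast; ring
  rw [h2] at h
  constructor
  · intro h0
    rw [h0, mul_zero] at h
    exact (mul_eq_zero.1 h).resolve_left (Complex.exp_ne_zero _)
  · intro h0
    rw [h0, mul_zero] at h
    exact (mul_eq_zero.1 h.symm).resolve_left (Complex.exp_ne_zero _)

theorem IsTheta₂.eq_zero {τ : UpperHalfPlane} {f : ℂ → ℂ} (hf : IsTheta₂ τ f)
    (h0 : fcoef f 0 = 0) (h1 : fcoef f 1 = 0) (z : ℂ) : f z = 0 := by
  refine eq_zero_of_fcoef_eq_zero hf.differentiable hf.add_one (fun n => ?_) z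
  suffices h : fcoef f n = 0 ∧ fcoef f (n + 1) = 0 from h.1
  induction n using Int.induction_on with
  | zero => exact ⟨h0, by simpa using h1⟩
  | succ n ih =>
    exact ⟨ih.2, by have := (hf.fcoef_add_two n).1 ih.1; rwa [add_assoc]⟩
  | pred n ih =>
    refine ⟨(hf.fcoef_add_two _).2 ?_, by simpa using ih.1⟩
    convert ih.2 using 2; ring

theorem fcoef_combination {f g k : ℂ → ℂ} (hf : Differentiable ℂ f) (hg : Differentiable ℂ g)
    (hk : Differentiable ℂ k) (a b c : ℂ) (n : ℤ) :
    fcoef (fun z => a * f z + b * g z + c * k z) n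
      = a * fcoef f n + b * fcoef g n + c * fcoef k n := by
  have hf := hf.continuous
  have hg := hg.continuous
  have hk := hk.continuous
  simp only [fcoef]
  rw [← intervalIntegral.integral_const_mul, ← intervalIntegral.integral_const_mul,
    ← intervalIntegral.integral_const_mul, ← intervalIntegral.integral_add,
    ← intervalIntegral.integral_add]
  · congr 1; ext x; ring
  all_goals apply Continuous.intervalIntegrable; fun_prop

/-- Theta functions of order `2` form a space of dimension at most `2`. -/
theorem IsTheta₂.exists_eq_combination {τ : UpperHalfPlane} {f g k : ℂ → ℂ} (hf : IsTheta₂ τ f)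
    (hg : IsTheta₂ τ g) (hk : IsTheta₂ τ k)
    (hind : ∀ a b : ℂ, (∀ z, a * f z + b * g z = 0) → a = 0 ∧ b = 0) :
    ∃ a b : ℂ, ∀ z, k z = a * f z + b * g z := by
  have hcomb : ∀ a b c : ℂ, IsTheta₂ τ (fun z => a * f z + b * g z + c * k z) := by
    intro a b c
    have h1 := hf.differentiable
    have h2 := hg.differentiable
    have h3 := hk.differentiable
    refine ⟨by fun_prop, fun z => by simp only [hf.add_one, hg.add_one, hk.add_one], fun z => ?_⟩
    simp only [hf.add_tau, hg.add_tau, hk.add_tau]; ring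
  have hfc := fcoef_combination hf.differentiable hg.differentiable hk.differentiable
  have hz : ∀ a b c : ℂ, a * fcoef f 0 + b * fcoef g 0 + c * fcoef k 0 = 0 →
      a * fcoef f 1 + b * fcoef g 1 + c * fcoef k 1 = 0 → ∀ z, a * f z + b * g z + c * k z = 0 :=
    fun a b c h0 h1 => (hcomb a b c).eq_zero (by rw [hfc, h0]) (by rw [hfc, h1])
  -- An order-2 theta function is determined by its coefficients 0 and 1, and D is the determinant
  -- of these for f and g. If D = 0, the combinations below vanish identically, independence makes
  -- all four coefficients zero, and then f itself is zero. Otherwise Cramer's rule gives the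
  -- coefficients.
  set D := fcoef f 0 * fcoef g 1 - fcoef f 1 * fcoef g 0 with hD
  by_cases hD0 : D = 0
  · exfalso
    have e1 := hind (fcoef g 1) (-fcoef f 1) fun z => by
      simpa using hz (fcoef g 1) (-fcoef f 1) 0 (by linear_combination hD0) (by ring) z
    have e0 := hind (fcoef g 0) (-fcoef f 0) fun z => by
      simpa using hz (fcoef g 0) (-fcoef f 0) 0 (by ring) (by linear_combination -hD0) z
    have := hind 1 0 fun z => by
      simpa using hz 1 0 0 (by simpa using e0.2) (by simpa using e1.2) z
    exact one_ne_zero this.1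
  · refine ⟨(fcoef k 0 * fcoef g 1 - fcoef k 1 * fcoef g 0) / D,
      (fcoef f 0 * fcoef k 1 - fcoef f 1 * fcoef k 0) / D, fun z => ?_⟩
    have := hz (fcoef k 0 * fcoef g 1 - fcoef k 1 * fcoef g 0)
      (fcoef f 0 * fcoef k 1 - fcoef f 1 * fcoef k 0) (-D) (by rw [hD]; ring) (by rw [hD]; ring) z
    field_simp
    linear_combination -this

/-! ### The theta function -/

theorem differentiable_theta (τ : UpperHalfPlane) : Differentiable ℂ (theta τ) := by
  intro z
  unfold theta
  have h : DifferentiableAt ℂ (fun z : ℂ => jacobiTheta₂ (z + (1 + τ) / 2) τ) z :=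
    (differentiableAt_jacobiTheta₂_fst (z + (1 + τ) / 2) τ.im_pos).comp z
      (differentiableAt_id.add_const _)
  fun_prop

theorem theta_add_one (τ : UpperHalfPlane) (z : ℂ) : theta τ (z + 1) = -theta τ z := by
  rw [theta, theta, show z + 1 + (1 + τ) / 2 = z + (1 + (τ : ℂ)) / 2 + 1 by ring,
    jacobiTheta₂_add_left, show Real.pi * I * ((τ : ℂ) / 4 + (z + 1))
      = Real.pi * I * (τ / 4 + z) + Real.pi * I by ring, Complex.exp_add, Complex.exp_pi_mul_I]
  ring

theorem theta_add_tau (τ : UpperHalfPlane) (z : ℂ) :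
    theta τ (z + τ) = -Complex.exp (-(Real.pi * I * (τ + 2 * z))) * theta τ z := by
  rw [theta, theta, show z + τ + (1 + τ) / 2 = z + (1 + (τ : ℂ)) / 2 + τ by ring,
    jacobiTheta₂_add_left', ← mul_assoc, ← mul_assoc, ← Complex.exp_add, ← neg_one_mul (Complex.exp _),
    ← Complex.exp_pi_mul_I, ← Complex.exp_add, ← Complex.exp_add]
  congr 1
  rw [Complex.exp_eq_exp_iff_exists_int]
  exact ⟨-1, by push_cast; ring⟩

/-- `jacobiTheta₂` is even, and the half period (1 + τ)/2 differs from its negative by the full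
period 1 + τ, so quasi-periodicity closes the computation. -/
theorem theta_neg (τ : UpperHalfPlane) (z : ℂ) : theta τ (-z) = -theta τ z := by
  have h : jacobiTheta₂ (-z + (1 + τ) / 2) τ
      = Complex.exp (2 * Real.pi * I * z) * -jacobiTheta₂ (z + (1 + τ) / 2) τ := by
    rw [← jacobiTheta₂_neg_left (-z + (1 + τ) / 2)]
    have h1 := jacobiTheta₂_add_left' (-(-z + (1 + τ) / 2)) τ
    have h2 := jacobiTheta₂_add_left (-(-z + (1 + τ) / 2) + τ) τ
    rw [show -(-z + (1 + τ) / 2) + (τ : ℂ) + 1 = z + (1 + τ) / 2 by ring, h1] at h2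
    rw [h2, mul_neg, ← mul_assoc, ← Complex.exp_add, ← neg_mul]
    nth_rw 1 [← one_mul (jacobiTheta₂ _ _)]
    congr 1
    rw [← mul_neg_one, ← Complex.exp_pi_mul_I, ← Complex.exp_add, eq_comm,
      Complex.exp_eq_one_iff]
    exact ⟨1, by push_cast; ring⟩
  rw [theta, theta, h, ← mul_assoc, ← Complex.exp_add, mul_neg]
  congr 3; ring

theorem theta_zero (τ : UpperHalfPlane) : theta τ 0 = 0 := by
  have := theta_neg τ 0
  rw [neg_zero] at this
  exact self_eq_neg.1 this

/-- Integrating the series of `jacobiTheta₂` over the real period [0, 1] kills every term except n =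
0, which contributes 1. -/
theorem exists_theta_ne_zero (τ : UpperHalfPlane) : ∃ z, theta τ z ≠ 0 := by
  by_contra! hcon
  have h0 : ∀ z, jacobiTheta₂ z τ = 0 := by
    intro z
    have := hcon (z - (1 + τ) / 2)
    rw [theta, sub_add_cancel] at this
    exact (mul_eq_zero.1 this).resolve_left (Complex.exp_ne_zero _)
  have hterm : ∀ n : ℤ, ∀ x : ℝ, ‖jacobiTheta₂_term n x τ‖ = ‖jacobiTheta₂_term n 0 τ‖ := by
    intro n x
    simp [norm_jacobiTheta₂_term]
  have hcont : ∀ n : ℤ, Continuous fun x : ℝ => jacobiTheta₂_term n x τ := by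
    intro n; unfold jacobiTheta₂_term; fun_prop
  have hsum : Summable fun n : ℤ => ‖jacobiTheta₂_term n 0 τ‖ :=
    ((summable_jacobiTheta₂_term_iff 0 τ).2 τ.im_pos).norm
  have hI := intervalIntegral.hasSum_integral_of_dominated_convergence (a := 0) (b := 1)
    (μ := MeasureTheory.volume) (F := fun (n : ℤ) (x : ℝ) => jacobiTheta₂_term n x τ)
    (f := fun x : ℝ => jacobiTheta₂ x τ) (fun n _ => ‖jacobiTheta₂_term n 0 τ‖)
    (fun n => (hcont n).aestronglyMeasurable)
    (fun n => .of_forall fun x _ => (hterm n x).le)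
    (.of_forall fun _ _ => hsum) (by simp)
    (.of_forall fun x _ => hasSum_jacobiTheta₂_term x τ.im_pos)
  have hval : ∀ n : ℤ, n ≠ 0 → ∫ x in (0 : ℝ)..1, jacobiTheta₂_term n x τ = 0 := by
    intro n hn
    have hc : (2 * Real.pi * I * n : ℂ) ≠ 0 := by simp [hn, Real.pi_ne_zero]
    have e : ∀ x : ℝ, jacobiTheta₂_term n x τ
        = Complex.exp (Real.pi * I * n ^ 2 * τ) * Complex.exp ((2 * Real.pi * I * n) * x) := by
      intro x; rw [jacobiTheta₂_term, ← Complex.exp_add]; congr 1; ring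
    simp only [e]
    rw [intervalIntegral.integral_const_mul, integral_exp_mul_complex hc]
    have : Complex.exp (2 * Real.pi * I * n) = 1 := by
      rw [mul_comm]; exact Complex.exp_int_mul_two_pi_mul_I n
    simp [this]
  have hs0 := hasSum_single (f := fun n : ℤ => ∫ x in (0 : ℝ)..1, jacobiTheta₂_term n x τ) 0 hval
  have := hI.unique hs0
  simp [h0, jacobiTheta₂_term] at this

/-! ### The Weierstrass function -/

theorem isOpen_compl_Λ (τ : UpperHalfPlane) : IsOpen ((Λ τ : Set ℂ)ᶜ) :=
  (periods τ).isClosed_lattice.isOpen_compl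

/-- A countable set does not disconnect the plane. This lets the identity theorem cancel factors and
remove exceptional points off the lattice. -/
theorem isPreconnected_compl_Λ (τ : UpperHalfPlane) : IsPreconnected ((Λ τ : Set ℂ)ᶜ) := by
  refine (Set.Countable.isConnected_compl_of_one_lt_rank (by simp) ?_).2
  exact countable_of_Lindelof_of_discrete (X := (periods τ).lattice)

theorem one_mem_Λ (τ : UpperHalfPlane) : (1 : ℂ) ∈ Λ τ := (periods τ).ω₁_mem_lattice

theorem tau_mem_Λ (τ : UpperHalfPlane) : (τ : ℂ) ∈ Λ τ := (periods τ).ω₂_mem_lattice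

theorem add_mem_Λ_iff (τ : UpperHalfPlane) {l z : ℂ} (hl : l ∈ Λ τ) : z + l ∈ Λ τ ↔ z ∈ Λ τ :=
  (Λ τ).add_mem_iff_left hl

theorem wp_add (τ : UpperHalfPlane) {l : ℂ} (hl : l ∈ Λ τ) (z : ℂ) : wp τ (z + l) = wp τ z :=
  (periods τ).weierstrassP_add_coe z ⟨l, hl⟩

theorem wp_neg (τ : UpperHalfPlane) (z : ℂ) : wp τ (-z) = wp τ z :=
  (periods τ).weierstrassP_neg z

theorem analyticOnNhd_wp (τ : UpperHalfPlane) : AnalyticOnNhd ℂ (wp τ) (Λ τ : Set ℂ)ᶜ :=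
  (periods τ).analyticOnNhd_weierstrassP

theorem analyticOnNhd_wp' (τ : UpperHalfPlane) : AnalyticOnNhd ℂ (wp' τ) (Λ τ : Set ℂ)ᶜ :=
  (analyticOnNhd_wp τ).deriv

theorem hasDerivAt_wp (τ : UpperHalfPlane) {z : ℂ} (hz : z ∉ Λ τ) :
    HasDerivAt (wp τ) (wp' τ z) z :=
  (analyticOnNhd_wp τ z hz).differentiableAt.hasDerivAt

theorem hasDerivAt_wp' (τ : UpperHalfPlane) {z : ℂ} (hz : z ∉ Λ τ) :
    HasDerivAt (wp' τ) (deriv (wp' τ) z) z :=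
  (analyticOnNhd_wp' τ z hz).differentiableAt.hasDerivAt

theorem wp'_sq (τ : UpperHalfPlane) {z : ℂ} (hz : z ∉ Λ τ) :
    wp' τ z ^ 2 = 4 * wp τ z ^ 3 - (periods τ).g₂ * wp τ z - (periods τ).g₃ := by
  have h : wp' τ z = (periods τ).derivWeierstrassP z := by
    rw [← PeriodPair.deriv_weierstrassP]; rfl
  rw [h]
  exact (periods τ).derivWeierstrassP_sq z hz

/-- The Weierstrass function is not constant. -/
theorem exists_wp_ne (τ : UpperHalfPlane) (c : ℂ) : ∃ z, z ∉ Λ τ ∧ wp τ z ≠ c := by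
  by_contra! hcon
  have h0 : (0 : ℂ) ∈ (periods τ).lattice := zero_mem _
  have hord := (periods τ).order_weierstrassP 0 h0
  have hev : wp τ =ᶠ[nhdsWithin 0 {0}ᶜ] fun _ => c := by
    have := (periods τ).compl_lattice_sdiff_singleton_mem_nhds 0
    filter_upwards [nhdsWithin_le_nhds this, self_mem_nhdsWithin] with z hz hz0
    exact hcon z fun hm => hz ⟨hm, hz0⟩
  have h2 : meromorphicOrderAt (wp τ) 0 = meromorphicOrderAt (fun _ : ℂ => c) 0 :=
    meromorphicOrderAt_congr hev
  have h3 : 0 ≤ meromorphicOrderAt (fun _ : ℂ => c) 0 :=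
    (analyticAt_const (𝕜 := ℂ)).meromorphicOrderAt_nonneg
  rw [← h2] at h3
  change meromorphicOrderAt (wp τ) 0 = _ at hord
  rw [hord] at h3
  exact absurd h3 (by decide)

theorem exists_wp'_ne_zero (τ : UpperHalfPlane) : ∃ z, z ∉ Λ τ ∧ wp' τ z ≠ 0 := by
  by_contra! hcon
  obtain ⟨z₀, hz₀, -⟩ := exists_wp_ne τ 0
  obtain ⟨z, hz, hne⟩ := exists_wp_ne τ (wp τ z₀)
  exact hne <| (isOpen_compl_Λ τ).is_const_of_deriv_eq_zero (isPreconnected_compl_Λ τ)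
    (analyticOnNhd_wp τ).differentiableOn (fun w hw => hcon w hw) hz hz₀

/-- Differentiating the cubic relation gives the formula multiplied by ℘'. The factor ℘' is not
identically zero and may be cancelled by the identity theorem. -/
theorem deriv_wp' (τ : UpperHalfPlane) {z : ℂ} (hz : z ∉ Λ τ) :
    deriv (wp' τ) z = 6 * wp τ z ^ 2 - (periods τ).g₂ / 2 := by
  have hmul : ∀ z ∈ (Λ τ : Set ℂ)ᶜ,
      wp' τ z * (deriv (wp' τ) z - (6 * wp τ z ^ 2 - (periods τ).g₂ / 2)) = 0 := by
    intro z hz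
    have h1 := (hasDerivAt_wp' τ hz).pow 2
    have h2 := ((((hasDerivAt_wp τ hz).pow 3).const_mul 4).sub
      ((hasDerivAt_wp τ hz).const_mul (periods τ).g₂)).sub_const (periods τ).g₃
    have hev : wp' τ ^ 2 =ᶠ[nhds z] fun z => (4 * wp τ z ^ 3 - (periods τ).g₂ * wp τ z)
        - (periods τ).g₃ := by
      filter_upwards [(isOpen_compl_Λ τ).mem_nhds hz] with w hw using wp'_sq τ hw
    have := h1.unique (h2.congr_of_eventuallyEq hev)
    push_cast at this
    linear_combination this / 2
  rcases (analyticOnNhd_wp' τ).eq_zero_or_eq_zero_of_mul_eq_zero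
    ((analyticOnNhd_wp' τ).deriv.sub (((analyticOnNhd_wp τ).pow 2).const_smul (c := (6 : ℂ)) |>.sub
      analyticOnNhd_const)) hmul (isPreconnected_compl_Λ τ) with h | h
  · obtain ⟨w, hw, hne⟩ := exists_wp'_ne_zero τ
    exact absurd (h w hw) hne
  · exact sub_eq_zero.1 (h z hz)

/-- A function analytic off the lattice vanishes if it vanishes where `℘ ≠ ℘(w)`. -/
theorem eq_zero_of_wp_ne (τ : UpperHalfPlane) {f : ℂ → ℂ} (hf : AnalyticOnNhd ℂ f (Λ τ : Set ℂ)ᶜ)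
    (w : ℂ) (h : ∀ z, z ∉ Λ τ → wp τ z - wp τ w ≠ 0 → f z = 0) {z : ℂ} (hz : z ∉ Λ τ) : f z = 0 := by
  rcases hf.eq_zero_or_eq_zero_of_mul_eq_zero (g := fun z => wp τ z - wp τ w)
    ((analyticOnNhd_wp τ).sub analyticOnNhd_const) (fun z hz => by
      by_cases h0 : wp τ z - wp τ w = 0
      · rw [h0, mul_zero]
      · rw [h z hz h0, zero_mul]) (isPreconnected_compl_Λ τ) with h | h
  · exact h z hz
  · obtain ⟨y, hy, hne⟩ := exists_wp_ne τ (wp τ w)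
    exact absurd (sub_eq_zero.1 (h y hy)) hne

/-! ### The addition theorem -/

theorem theta_eq_zero_of_mem (τ : UpperHalfPlane) {l : ℂ} (hl : l ∈ Λ τ) : theta τ l = 0 := by
  have h1 : ∀ z, theta τ (z + 1) = 0 ↔ theta τ z = 0 := fun z => by simp [theta_add_one]
  have h2 : ∀ z, theta τ (z + τ) = 0 ↔ theta τ z = 0 := fun z => by simp [theta_add_tau]
  have key : ∀ l ∈ AddSubgroup.closure {(1 : ℂ), (τ : ℂ)}, ∀ z,
      theta τ (z + l) = 0 ↔ theta τ z = 0 := by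
    intro l hl
    induction hl using AddSubgroup.closure_induction with
    | mem x hx =>
      rcases hx with rfl | rfl
      · exact h1
      · exact h2
    | zero => simp
    | add x y _ _ hx hy => intro z; rw [← add_assoc, hy, hx]
    | neg x _ hx => intro z; rw [← hx (z + -x), neg_add_cancel_right]
  have hl' : l ∈ AddSubgroup.closure {(1 : ℂ), (τ : ℂ)} := by
    rw [← Submodule.mem_toAddSubgroup] at hl
    convert hl using 1
    exact (Submodule.span_int_eq_addSubgroupClosure _).symm
  have := (key l hl' 0).2 (theta_zero τ)
  rwa [zero_add] at this

open Classical in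
/-- The entire function `ϑ² ℘`. -/
def thetaSqWp (τ : UpperHalfPlane) (z : ℂ) : ℂ :=
  if z ∈ Λ τ then deriv (theta τ) z ^ 2 else theta τ z ^ 2 * wp τ z

theorem thetaSqWp_of_mem (τ : UpperHalfPlane) {z : ℂ} (hz : z ∈ Λ τ) :
    thetaSqWp τ z = deriv (theta τ) z ^ 2 := if_pos hz

theorem thetaSqWp_of_notMem (τ : UpperHalfPlane) {z : ℂ} (hz : z ∉ Λ τ) :
    thetaSqWp τ z = theta τ z ^ 2 * wp τ z := if_neg hz

theorem differentiable_thetaSqWp (τ : UpperHalfPlane) : Differentiable ℂ (thetaSqWp τ) := by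
  intro l
  by_cases hl : l ∈ Λ τ
  · have hk : DifferentiableAt ℂ (dslope (theta τ) l) l := by
      have hd := (differentiable_theta τ).differentiableOn (s := Set.univ)
      exact ((Complex.differentiableOn_dslope Filter.univ_mem).2 hd).differentiableAt
        Filter.univ_mem
    have hmem := (periods τ).compl_lattice_sdiff_singleton_mem_nhds l
    have hp : DifferentiableAt ℂ ((periods τ).weierstrassPExcept l) l :=
      (((periods τ).differentiableOn_weierstrassPExcept l) l (by simp)).differentiableAt hmem
    -- Near l the simple factor z - l of ϑ cancels the double pole of ℘: ϑ = (z - l) · `dslope`, and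
    -- ℘ = `weierstrassPExcept` + 1/(z - l)² - 1/l². At l = 0 the convention 1/0 = 0 gives the
    -- correct term.
    have hg : DifferentiableAt ℂ (fun z => dslope (theta τ) l z ^ 2
        * (1 + (z - l) ^ 2 * ((periods τ).weierstrassPExcept l z - 1 / l ^ 2))) l := by
      fun_prop
    refine hg.congr_of_eventuallyEq ?_
    filter_upwards [hmem] with z hz
    by_cases hzl : z = l
    · subst hzl
      rw [thetaSqWp_of_mem τ hl, dslope_same]; simp
    · have hz' : z ∉ Λ τ := fun hm => hz ⟨hm, hzl⟩
      have h0 : z - l ≠ 0 := sub_ne_zero.2 hzl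
      have hw := (periods τ).weierstrassPExcept_add ⟨l, hl⟩ z
      change _ = wp τ z at hw
      rw [thetaSqWp_of_notMem τ hz', ← hw, dslope_of_ne _ hzl, slope_def_field,
        theta_eq_zero_of_mem τ hl]
      simp only [one_div]
      field_simp
      ring
  · have hev : thetaSqWp τ =ᶠ[nhds l] fun z => theta τ z ^ 2 * wp τ z := by
      filter_upwards [(isOpen_compl_Λ τ).mem_nhds hl] with z hz using thetaSqWp_of_notMem τ hz
    refine DifferentiableAt.congr_of_eventuallyEq ?_ hev
    exact ((differentiable_theta τ l).pow 2).mul (hasDerivAt_wp τ hl).differentiableAt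

theorem hasDerivAt_theta (τ : UpperHalfPlane) (z : ℂ) :
    HasDerivAt (theta τ) (deriv (theta τ) z) z := (differentiable_theta τ z).hasDerivAt

theorem deriv_theta_add_one (τ : UpperHalfPlane) (z : ℂ) :
    deriv (theta τ) (z + 1) = -deriv (theta τ) z := by
  have h1 := (hasDerivAt_theta τ (z + 1)).comp_add_const z 1
  have h2 := (hasDerivAt_theta τ z).neg
  exact h1.unique (h2.congr_of_eventuallyEq (.of_forall fun w => theta_add_one τ w))

/-- At a zero of ϑ the derivative of the multiplier drops out, so ϑ' transforms like ϑ. -/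
theorem deriv_theta_add_tau (τ : UpperHalfPlane) {z : ℂ} (hz : theta τ z = 0) :
    deriv (theta τ) (z + τ) = -Complex.exp (-(Real.pi * I * (τ + 2 * z))) * deriv (theta τ) z := by
  have h1 := (hasDerivAt_theta τ (z + τ)).comp_add_const z (τ : ℂ)
  have h3 : DifferentiableAt ℂ (fun z : ℂ => -Complex.exp (-(Real.pi * I * (τ + 2 * z)))) z := by
    fun_prop
  have h2 := h3.hasDerivAt.mul (hasDerivAt_theta τ z)
  have := h1.unique (h2.congr_of_eventuallyEq (.of_forall fun w => theta_add_tau τ w))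
  rw [this, hz, mul_zero, zero_add]

theorem exp_tau_sq (τ z : ℂ) : (-Complex.exp (-(Real.pi * I * (τ + 2 * z)))) ^ 2
    = Complex.exp (-(2 * Real.pi * I * (τ + 2 * z))) := by
  rw [neg_sq, ← Complex.exp_nat_mul]
  congr 1; push_cast; ring

theorem isTheta₂_theta_sq (τ : UpperHalfPlane) : IsTheta₂ τ (fun z => theta τ z ^ 2) where
  differentiable := (differentiable_theta τ).pow 2
  add_one z := by rw [theta_add_one, neg_sq]
  add_tau z := by rw [theta_add_tau, mul_pow, exp_tau_sq]

theorem isTheta₂_thetaSqWp (τ : UpperHalfPlane) : IsTheta₂ τ (thetaSqWp τ) where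
  differentiable := differentiable_thetaSqWp τ
  add_one z := by
    by_cases hz : z ∈ Λ τ
    · rw [thetaSqWp_of_mem τ hz, thetaSqWp_of_mem τ ((add_mem_Λ_iff τ (one_mem_Λ τ)).2 hz),
        deriv_theta_add_one, neg_sq]
    · rw [thetaSqWp_of_notMem τ hz, thetaSqWp_of_notMem τ (by rwa [add_mem_Λ_iff τ (one_mem_Λ τ)]),
        theta_add_one, neg_sq, wp_add τ (one_mem_Λ τ)]
  add_tau z := by
    by_cases hz : z ∈ Λ τ
    · rw [thetaSqWp_of_mem τ hz, thetaSqWp_of_mem τ ((add_mem_Λ_iff τ (tau_mem_Λ τ)).2 hz),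
        deriv_theta_add_tau τ (theta_eq_zero_of_mem τ hz), mul_pow, exp_tau_sq]
    · rw [thetaSqWp_of_notMem τ hz, thetaSqWp_of_notMem τ (by rwa [add_mem_Λ_iff τ (tau_mem_Λ τ)]),
        theta_add_tau, mul_pow, exp_tau_sq, wp_add τ (tau_mem_Λ τ), mul_assoc]

theorem isTheta₂_theta_mul_theta (τ : UpperHalfPlane) (w : ℂ) :
    IsTheta₂ τ (fun z => theta τ (z + w) * theta τ (z - w)) where
  differentiable := by have := differentiable_theta τ; fun_prop
  add_one z := by
    rw [show z + 1 + w = z + w + 1 by ring, show z + 1 - w = z - w + 1 by ring, theta_add_one,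
      theta_add_one, neg_mul_neg]
  add_tau z := by
    rw [show z + τ + w = z + w + τ by ring, show z + τ - w = z - w + τ by ring, theta_add_tau,
      theta_add_tau, mul_mul_mul_comm, neg_mul_neg, ← Complex.exp_add]
    congr 2; ring

theorem eq_zero_or_eq_zero_of_entire {f g : ℂ → ℂ} (hf : Differentiable ℂ f)
    (hg : Differentiable ℂ g) (h : ∀ z, f z * g z = 0) : (∀ z, f z = 0) ∨ ∀ z, g z = 0 := by
  have := (hf.differentiableOn.analyticOnNhd isOpen_univ).eq_zero_or_eq_zero_of_mul_eq_zero
    (hg.differentiableOn.analyticOnNhd isOpen_univ) (fun z _ => h z) isPreconnected_univ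
  simpa using this

/-- The functions ϑ² and ϑ²℘ span the order-2 theta functions: they are independent because ϑ is not
identically zero and ℘ is not constant. -/
theorem theta_mul_theta_eq (τ : UpperHalfPlane) (w : ℂ) :
    ∃ a b : ℂ, ∀ z, theta τ (z + w) * theta τ (z - w) = a * theta τ z ^ 2 + b * thetaSqWp τ z := by
  refine (isTheta₂_theta_sq τ).exists_eq_combination (isTheta₂_thetaSqWp τ)
    (isTheta₂_theta_mul_theta τ w) fun a b hab => ?_
  have hne : ∀ c d : ℂ, (∀ z, z ∉ Λ τ → c + d * wp τ z = 0) → c = 0 ∧ d = 0 := by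
    intro c d hcd
    have hd : d = 0 := by
      by_contra hd
      obtain ⟨z, hz, hzne⟩ := exists_wp_ne τ (-c / d)
      apply hzne
      have := hcd z hz
      field_simp
      linear_combination this
    obtain ⟨z, hz, -⟩ := exists_wp_ne τ 0
    have := hcd z hz
    simp only [hd, zero_mul, add_zero] at this
    exact ⟨this, hd⟩
  refine hne a b ?_
  have hsm : AnalyticOnNhd ℂ (fun z => theta τ z ^ 2) (Λ τ : Set ℂ)ᶜ :=
    fun z _ => ((differentiable_theta τ).analyticAt z).pow 2
  -- The zeros of ϑ off the lattice are not yet excluded, so ϑ² is cancelled by the identity theorem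
  -- rather than pointwise.
  rcases hsm.eq_zero_or_eq_zero_of_mul_eq_zero (g := fun z => a + b * wp τ z)
    (analyticOnNhd_const.add (analyticOnNhd_const.mul (analyticOnNhd_wp τ)))
    (fun z hz => by
      have := hab z
      rw [thetaSqWp_of_notMem τ hz] at this
      linear_combination this) (isPreconnected_compl_Λ τ) with h | h
  · obtain ⟨z, hz⟩ := exists_theta_ne_zero τ
    exact absurd (h z fun hm => hz (theta_eq_zero_of_mem τ hm)) (pow_ne_zero 2 hz)
  · exact h

/-- If ϑ'(0) = 0, both basis functions ϑ² and ϑ²℘ vanish at 0, whereas ϑ(w)ϑ(-w) = -ϑ(w)² need not.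
-/
theorem deriv_theta_zero_ne_zero (τ : UpperHalfPlane) : deriv (theta τ) 0 ≠ 0 := by
  intro h0
  obtain ⟨w, hw⟩ := exists_theta_ne_zero τ
  obtain ⟨a, b, hab⟩ := theta_mul_theta_eq τ w
  have := hab 0
  rw [thetaSqWp_of_mem τ (zero_mem _), h0, theta_zero, zero_add, zero_sub, theta_neg] at this
  simp [hw] at this

theorem theta_eq_zero_iff (τ : UpperHalfPlane) {w : ℂ} : theta τ w = 0 ↔ w ∈ Λ τ := by
  refine ⟨fun hw => ?_, theta_eq_zero_of_mem τ⟩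
  by_contra hwΛ
  obtain ⟨y, hy⟩ := exists_theta_ne_zero τ
  -- At a zero w off the lattice both ϑ² and ϑ²℘ vanish. Expanding ϑ(y + z)ϑ(y - z) in y and setting
  -- y = w makes the product zero for every z, which would force ϑ to vanish identically.
  have hz : ∀ z, theta τ (z + w) * theta τ (z - w) = 0 := by
    intro z
    obtain ⟨a, b, hab⟩ := theta_mul_theta_eq τ z
    have := hab w
    rw [thetaSqWp_of_notMem τ hwΛ, hw, ← neg_sub z w, theta_neg, add_comm] at this
    linear_combination -this
  have hd := differentiable_theta τ
  rcases eq_zero_or_eq_zero_of_entire (by fun_prop) (by fun_prop) hz with h | h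
  · exact hy (by simpa using h (y - w))
  · exact hy (by simpa using h (y + w))

theorem theta_ne_zero (τ : UpperHalfPlane) {w : ℂ} (hw : w ∉ Λ τ) : theta τ w ≠ 0 :=
  fun h => hw ((theta_eq_zero_iff τ).1 h)

/-- The addition theorem
`ϑ(z + w) ϑ(z - w) ϑ'(0)² = -ϑ(z)² ϑ(w)² (℘(z) - ℘(w))`. -/
theorem theta_addition (τ : UpperHalfPlane) {z w : ℂ} (hz : z ∉ Λ τ) (hw : w ∉ Λ τ) :
    theta τ (z + w) * theta τ (z - w) * deriv (theta τ) 0 ^ 2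
      = -(theta τ z ^ 2 * theta τ w ^ 2 * (wp τ z - wp τ w)) := by
  obtain ⟨a, b, hab⟩ := theta_mul_theta_eq τ w
  -- The two constants are fixed by z = 0, where bϑ'(0)² = -ϑ(w)², and by z = w, where a = -b℘(w).
  have h0 := hab 0
  rw [thetaSqWp_of_mem τ (zero_mem _), theta_zero, zero_add, zero_sub, theta_neg] at h0
  have h1 := hab w
  rw [thetaSqWp_of_notMem τ hw, sub_self, theta_zero, mul_zero] at h1
  have h2 : a = -b * wp τ w := by
    have : theta τ w ^ 2 * (a + b * wp τ w) = 0 := by linear_combination -h1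
    have := (mul_eq_zero.1 this).resolve_left (pow_ne_zero 2 (theta_ne_zero τ hw))
    linear_combination this
  rw [hab z, thetaSqWp_of_notMem τ hz, h2]
  linear_combination -(theta τ z ^ 2 * (wp τ z - wp τ w)) * h0

/-! ### Eisenstein functions -/

theorem analyticOnNhd_theta (τ : UpperHalfPlane) (s : Set ℂ) : AnalyticOnNhd ℂ (theta τ) s :=
  fun z _ => (differentiable_theta τ).analyticAt z

theorem analyticOnNhd_E₁ (τ : UpperHalfPlane) : AnalyticOnNhd ℂ (E₁ τ) (Λ τ : Set ℂ)ᶜ :=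
  (analyticOnNhd_theta τ _).deriv.div (analyticOnNhd_theta τ _) fun _ hz => theta_ne_zero τ hz

theorem analyticOnNhd_E₂ (τ : UpperHalfPlane) : AnalyticOnNhd ℂ (E₂ τ) (Λ τ : Set ℂ)ᶜ :=
  (analyticOnNhd_E₁ τ).deriv.neg

theorem hasDerivAt_E₁ (τ : UpperHalfPlane) {z : ℂ} (hz : z ∉ Λ τ) :
    HasDerivAt (E₁ τ) (-E₂ τ z) z := by
  rw [E₂, neg_neg]
  exact (analyticOnNhd_E₁ τ z hz).differentiableAt.hasDerivAt

theorem add_notMem_of_wp_ne (τ : UpperHalfPlane) {z w : ℂ} (hz : z ∉ Λ τ) (hw : w ∉ Λ τ)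
    (h : wp τ z - wp τ w ≠ 0) : z + w ∉ Λ τ := by
  intro hm
  have := theta_addition τ hz hw
  rw [(theta_eq_zero_iff τ).2 hm] at this
  simp [theta_ne_zero τ hz, theta_ne_zero τ hw, h] at this

/-- Take the logarithmic derivatives of the addition theorem in z and in w and add them: the terms
E₁(z - w) cancel. -/
theorem E₁_add (τ : UpperHalfPlane) {z w : ℂ} (hz : z ∉ Λ τ) (hw : w ∉ Λ τ)
    (h : wp τ z - wp τ w ≠ 0) :
    E₁ τ (z + w) = E₁ τ z + E₁ τ w + (wp' τ z - wp' τ w) / (2 * (wp τ z - wp τ w)) := by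
  have hT := theta_addition τ hz hw
  have hx := theta_ne_zero τ (add_notMem_of_wp_ne τ hz hw h)
  have hz0 := theta_ne_zero τ hz
  have hw0 := theta_ne_zero τ hw
  have dz := ((((hasDerivAt_theta τ (z + w)).comp_add_const z w).mul
    ((hasDerivAt_theta τ (z - w)).comp_sub_const z w)).mul_const (deriv (theta τ) 0 ^ 2)).unique
    (((((((hasDerivAt_theta τ z).pow 2).mul_const (theta τ w ^ 2)).mul
      ((hasDerivAt_wp τ hz).sub_const (wp τ w))).neg).congr_of_eventuallyEq (by
        filter_upwards [(isOpen_compl_Λ τ).mem_nhds hz] with y hy using theta_addition τ hy hw)))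
  have dw := ((((hasDerivAt_theta τ (z + w)).comp_const_add z w).mul
    ((hasDerivAt_theta τ (z - w)).comp_const_sub z w)).mul_const (deriv (theta τ) 0 ^ 2)).unique
    (((((((hasDerivAt_theta τ w).pow 2).const_mul (theta τ z ^ 2)).mul
      ((hasDerivAt_wp τ hw).const_sub (wp τ z))).neg).congr_of_eventuallyEq (by
        filter_upwards [(isOpen_compl_Λ τ).mem_nhds hw] with y hy using theta_addition τ hz hy)))
  push_cast at dz dw
  simp only [Pi.pow_apply] at dz dw
  have hy : theta τ (z - w) * deriv (theta τ) 0 ^ 2 ≠ 0 := by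
    intro h0
    rw [mul_assoc, h0, mul_zero] at hT
    simp [hz0, hw0, h] at hT
  have key : theta τ (z + w) * (theta τ (z - w) * deriv (theta τ) 0 ^ 2) * (E₁ τ (z + w)
      - (E₁ τ z + E₁ τ w + (wp' τ z - wp' τ w) / (2 * (wp τ z - wp τ w)))) = 0 := by
    have e : theta τ (z + w) * (theta τ (z - w) * deriv (theta τ) 0 ^ 2) * E₁ τ (z + w)
        = deriv (theta τ) (z + w) * (theta τ (z - w) * deriv (theta τ) 0 ^ 2) := by
      rw [E₁]; field_simp
    have hT' : theta τ (z + w) * (theta τ (z - w) * deriv (theta τ) 0 ^ 2) = _ :=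
      (mul_assoc _ _ _).symm.trans hT
    rw [mul_sub, e, hT', E₁, E₁]
    field_simp
    linear_combination dz + dw
  exact sub_eq_zero.1 ((mul_eq_zero.1 key).resolve_left (mul_ne_zero hx hy))

theorem E₂_add (τ : UpperHalfPlane) {z w : ℂ} (hz : z ∉ Λ τ) (hw : w ∉ Λ τ)
    (h : wp τ z - wp τ w ≠ 0) :
    E₂ τ (z + w) = E₂ τ z - ((6 * wp τ z ^ 2 - (periods τ).g₂ / 2) * (wp τ z - wp τ w)
      - (wp' τ z - wp' τ w) * wp' τ z) / (2 * (wp τ z - wp τ w) ^ 2) := by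
  have hd1 := (hasDerivAt_E₁ τ (add_notMem_of_wp_ne τ hz hw h)).comp_add_const z w
  have hden : HasDerivAt (fun y => 2 * (wp τ y - wp τ w)) (2 * wp' τ z) z :=
    ((hasDerivAt_wp τ hz).sub_const _).const_mul 2
  have hd2 := ((hasDerivAt_E₁ τ hz).add_const (E₁ τ w)).add
    (((hasDerivAt_wp' τ hz).sub_const (wp' τ w)).div hden (mul_ne_zero two_ne_zero h))
  have hopen : ∀ᶠ y in nhds z, wp τ y - wp τ w ≠ 0 :=
    ((hasDerivAt_wp τ hz).continuousAt.sub continuousAt_const).eventually_ne h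
  have := hd1.unique (hd2.congr_of_eventuallyEq (by
    filter_upwards [(isOpen_compl_Λ τ).mem_nhds hz, hopen] with y hy hy' using E₁_add τ hy hw hy'))
  rw [deriv_wp' τ hz] at this
  rw [← neg_neg (E₂ τ (z + w)), this]
  field_simp
  ring

/-- `E₂ - ℘` is constant. -/
theorem E₂_sub_E₂ (τ : UpperHalfPlane) {z w : ℂ} (hz : z ∉ Λ τ) (hw : w ∉ Λ τ) :
    E₂ τ z - E₂ τ w = wp τ z - wp τ w := by
  refine sub_eq_zero.1 (eq_zero_of_wp_ne τ
    (f := fun z => E₂ τ z - E₂ τ w - (wp τ z - wp τ w))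
    (((analyticOnNhd_E₂ τ).sub analyticOnNhd_const).sub
      ((analyticOnNhd_wp τ).sub analyticOnNhd_const)) w (fun z hz h => ?_) hz)
  have h' : wp τ w - wp τ z ≠ 0 := by rw [← neg_sub]; exact neg_ne_zero.2 h
  -- Expanding E₂(z + w) around z and around w and comparing gives E₂(z) - E₂(w) as a rational
  -- expression in ℘ and ℘', which the cubic relation reduces to ℘(z) - ℘(w).
  have e1 := E₂_add τ hz hw h
  have e2 := E₂_add τ hw hz h'
  rw [add_comm w z, e1] at e2
  have s1 := wp'_sq τ hz
  have s2 := wp'_sq τ hw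
  have e3 : (E₂ τ z - E₂ τ w) * (2 * (wp τ z - wp τ w) ^ 2)
      = (6 * wp τ z ^ 2 - (periods τ).g₂ / 2) * (wp τ z - wp τ w)
        - (wp' τ z - wp' τ w) * wp' τ z
        - ((6 * wp τ w ^ 2 - (periods τ).g₂ / 2) * (wp τ w - wp τ z)
        - (wp' τ w - wp' τ z) * wp' τ w) := by
    rw [show (wp τ w - wp τ z) ^ 2 = (wp τ z - wp τ w) ^ 2 by ring] at e2
    field_simp at e2
    linear_combination e2 / 2
  have h2 : 2 * (wp τ z - wp τ w) ^ 2 ≠ 0 := mul_ne_zero two_ne_zero (pow_ne_zero 2 h)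
  apply mul_right_cancel₀ h2
  linear_combination e3 - s1 + s2

theorem hasDerivAt_E₂ (τ : UpperHalfPlane) {z : ℂ} (hz : z ∉ Λ τ) :
    HasDerivAt (E₂ τ) (wp' τ z) z := by
  refine ((hasDerivAt_wp τ hz).add_const (E₂ τ z - wp τ z)).congr_of_eventuallyEq ?_
  filter_upwards [(isOpen_compl_Λ τ).mem_nhds hz] with y hy
  linear_combination E₂_sub_E₂ τ hy hz

/-! ### The Kronecker function `φ` -/

theorem analyticOnNhd_phi (τ : UpperHalfPlane) {z : ℂ} (hz : z ∉ Λ τ) :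
    AnalyticOnNhd ℂ (fun u => phi τ u z) (Λ τ : Set ℂ)ᶜ := by
  intro u hu
  have h1 : AnalyticAt ℂ (fun u => theta τ (u + z)) u := by
    have := differentiable_theta τ
    exact Differentiable.analyticAt (by fun_prop) u
  exact (h1.mul analyticAt_const).div (((differentiable_theta τ).analyticAt u).mul analyticAt_const)
    (mul_ne_zero (theta_ne_zero τ hu) (theta_ne_zero τ hz))

theorem analyticOnNhd_phi' (τ : UpperHalfPlane) {z : ℂ} (hz : z ∉ Λ τ) :
    AnalyticOnNhd ℂ (fun u => phi' τ u z) (Λ τ : Set ℂ)ᶜ :=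
  (analyticOnNhd_phi τ hz).deriv

theorem hasDerivAt_phi (τ : UpperHalfPlane) {u z : ℂ} (hu : u ∉ Λ τ) (hz : z ∉ Λ τ) :
    HasDerivAt (fun u => phi τ u z) (phi' τ u z) u :=
  (analyticOnNhd_phi τ hz u hu).differentiableAt.hasDerivAt

theorem phi'_eq (τ : UpperHalfPlane) {u z : ℂ} (hu : u ∉ Λ τ) (hz : z ∉ Λ τ) :
    phi' τ u z = (deriv (theta τ) (u + z) - theta τ (u + z) * E₁ τ u) * deriv (theta τ) 0
      / (theta τ u * theta τ z) := by
  have hu0 := theta_ne_zero τ hu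
  have hz0 := theta_ne_zero τ hz
  have h := (((hasDerivAt_theta τ (u + z)).comp_add_const u z).mul_const (deriv (theta τ) 0)).div
    ((hasDerivAt_theta τ u).mul_const (theta τ z)) (mul_ne_zero hu0 hz0)
  rw [phi', E₁]
  refine h.deriv.trans ?_
  field_simp

theorem phi'_eq_mul (τ : UpperHalfPlane) {u z : ℂ} (hu : u ∉ Λ τ) (hz : z ∉ Λ τ)
    (huz : u + z ∉ Λ τ) : phi' τ u z = phi τ u z * (E₁ τ (u + z) - E₁ τ u) := by
  have h0 := theta_ne_zero τ huz
  rw [phi'_eq τ hu hz, phi, E₁, E₁]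
  field_simp

/-- `φ` satisfies the Lamé equation in its first argument. -/
theorem hasDerivAt_phi' (τ : UpperHalfPlane) {u z : ℂ} (hu : u ∉ Λ τ) (hz : z ∉ Λ τ) :
    HasDerivAt (fun u => phi' τ u z) (2 * E₁ τ z * phi' τ u z - E₁ τ z ^ 2 * phi τ u z
      + (2 * wp τ u + wp τ z) * phi τ u z) u := by
  have hphi := analyticOnNhd_phi τ hz
  have hphi' := analyticOnNhd_phi' τ hz
  refine HasDerivAt.congr_deriv (hphi' u hu).differentiableAt.hasDerivAt ?_
  refine sub_eq_zero.1 (eq_zero_of_wp_ne τ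
    (f := fun u => deriv (fun u => phi' τ u z) u - (2 * E₁ τ z * phi' τ u z
      - E₁ τ z ^ 2 * phi τ u z + (2 * wp τ u + wp τ z) * phi τ u z)) ?_ z (fun u hu h => ?_) hu)
  · exact hphi'.deriv.sub (((analyticOnNhd_const.mul hphi').sub (analyticOnNhd_const.mul hphi)).add
      (((analyticOnNhd_const.mul (analyticOnNhd_wp τ)).add analyticOnNhd_const).mul hphi))
  -- Away from ℘(u) = ℘(z), the logarithmic derivative φ'/φ is E₁(u + z) - E₁(u). Differentiating
  -- once more and inserting the addition formulas and the cubic relation gives the equation; the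
  -- excluded points are recovered by analytic continuation.
  have huz := add_notMem_of_wp_ne τ hu hz h
  have hev : (fun u => phi' τ u z) =ᶠ[nhds u] fun u => phi τ u z * (E₁ τ (u + z) - E₁ τ u) := by
    have hc : ContinuousAt (fun u : ℂ => u + z) u := by fun_prop
    filter_upwards [(isOpen_compl_Λ τ).mem_nhds hu, hc ((isOpen_compl_Λ τ).mem_nhds huz)]
      with y hy hyz using phi'_eq_mul τ hy hz hyz
  have hd := ((hasDerivAt_phi τ hu hz).mul (((hasDerivAt_E₁ τ huz).comp_add_const u z).sub
    (hasDerivAt_E₁ τ hu))).congr_of_eventuallyEq hev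
  simp only [Pi.sub_apply] at hd
  rw [hd.deriv, phi'_eq_mul τ hu hz huz, E₁_add τ hu hz h, E₂_add τ hu hz h]
  have s1 := wp'_sq τ hu
  have s2 := wp'_sq τ hz
  field_simp
  linear_combination (-phi τ u z) * s1 + phi τ u z * s2

theorem phi_mul_phi_neg (τ : UpperHalfPlane) {u z : ℂ} (hu : u ∉ Λ τ) (hz : z ∉ Λ τ) :
    phi τ u z * phi τ (-u) z = wp τ z - wp τ u := by
  have hu0 := theta_ne_zero τ hu
  have hz0 := theta_ne_zero τ hz
  have := theta_addition τ hz hu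
  rw [phi, phi, theta_neg, add_comm u z, neg_add_eq_sub]
  field_simp
  linear_combination -this

theorem neg_notMem (τ : UpperHalfPlane) {u : ℂ} (hu : u ∉ Λ τ) : -u ∉ Λ τ := by
  rwa [neg_mem_iff]

/-- This is the u-derivative of `phi_mul_phi_neg`. -/
theorem phi_wronskian (τ : UpperHalfPlane) {u z : ℂ} (hu : u ∉ Λ τ) (hz : z ∉ Λ τ) :
    phi' τ u z * phi τ (-u) z - phi τ u z * phi' τ (-u) z = -wp' τ u := by
  have h1 := (hasDerivAt_phi τ hu hz).mul
    ((hasDerivAt_phi τ (neg_notMem τ hu) hz).comp u (hasDerivAt_neg u))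
  have h2 := (hasDerivAt_wp τ hu).const_sub (wp τ z)
  have := h1.unique (h2.congr_of_eventuallyEq (by
    filter_upwards [(isOpen_compl_Λ τ).mem_nhds hu] with y hy using phi_mul_phi_neg τ hy hz))
  simp only [Function.comp] at this
  linear_combination this

theorem phi_neg_self (τ : UpperHalfPlane) (u : ℂ) : phi τ u (-u) = 0 := by
  rw [phi, add_neg_cancel, theta_zero, zero_mul, zero_div]

/-- Together with `phi_neg_self`: z = -u is a simple zero of w ↦ φ(w, z) at w = u. This choice of
spectral parameter later isolates `defectU`. -/
theorem phi'_neg_self_ne_zero (τ : UpperHalfPlane) {u : ℂ} (hu : u ∉ Λ τ) :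
    phi' τ u (-u) ≠ 0 := by
  rw [phi'_eq τ hu (neg_notMem τ hu), add_neg_cancel, theta_zero, zero_mul, sub_zero]
  exact div_ne_zero (mul_ne_zero (deriv_theta_zero_ne_zero τ) (deriv_theta_zero_ne_zero τ))
    (mul_ne_zero (theta_ne_zero τ hu) (theta_ne_zero τ (neg_notMem τ hu)))

theorem wp'_neg (τ : UpperHalfPlane) {z : ℂ} (hz : z ∉ Λ τ) : wp' τ (-z) = -wp' τ z := by
  have h := (hasDerivAt_wp τ (neg_notMem τ hz)).comp z (hasDerivAt_neg z)
  have := h.unique ((hasDerivAt_wp τ hz).congr_of_eventuallyEq (.of_forall fun y => wp_neg τ y))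
  linear_combination -this

theorem E₂_neg (τ : UpperHalfPlane) {z : ℂ} (hz : z ∉ Λ τ) : E₂ τ (-z) = E₂ τ z := by
  have := E₂_sub_E₂ τ (neg_notMem τ hz) hz
  rwa [wp_neg, sub_self, sub_eq_zero] at this

/-! ### Smooth fields -/

section Fields

variable {J : Set ℝ} {f : ℝ → ℝ → ℂ}

theorem isOpen_univ_prod (hJ : IsOpen J) : IsOpen ((Set.univ : Set ℝ) ×ˢ J) := isOpen_univ.prod hJ

theorem SmoothField.contDiffAt (hf : SmoothField J f) (hJ : IsOpen J) (x : ℝ) {t : ℝ} (ht : t ∈ J) :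
    ContDiffAt ℝ ∞ (Function.uncurry f) (x, t) :=
  ContDiffOn.contDiffAt hf ((isOpen_univ_prod hJ).mem_nhds ⟨trivial, ht⟩)

theorem SmoothField.hasFDerivAt (hf : SmoothField J f) (hJ : IsOpen J) (x : ℝ) {t : ℝ}
    (ht : t ∈ J) :
    HasFDerivAt (Function.uncurry f) (fderiv ℝ (Function.uncurry f) (x, t)) (x, t) :=
  ((hf.contDiffAt hJ x ht).differentiableAt (by simp)).hasFDerivAt

theorem hasDerivAt_prodMk_left (x t : ℝ) : HasDerivAt (fun y : ℝ => (y, t)) ((1 : ℝ), (0 : ℝ)) x :=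
  (hasDerivAt_id x).prodMk (hasDerivAt_const x t)

theorem hasDerivAt_prodMk_right (x t : ℝ) :
    HasDerivAt (fun s : ℝ => (x, s)) ((0 : ℝ), (1 : ℝ)) t :=
  (hasDerivAt_const t x).prodMk (hasDerivAt_id t)

theorem SmoothField.hasDerivAt_fst (hf : SmoothField J f) (hJ : IsOpen J) (x : ℝ) {t : ℝ}
    (ht : t ∈ J) :
    HasDerivAt (fun y => f y t) (fderiv ℝ (Function.uncurry f) (x, t) (1, 0)) x :=
  HasFDerivAt.comp_hasDerivAt (f := fun y : ℝ => (y, t)) x (hf.hasFDerivAt hJ x ht)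
    (hasDerivAt_prodMk_left x t)

theorem SmoothField.hasDerivAt_snd (hf : SmoothField J f) (hJ : IsOpen J) (x : ℝ) {t : ℝ}
    (ht : t ∈ J) :
    HasDerivAt (fun s => f x s) (fderiv ℝ (Function.uncurry f) (x, t) (0, 1)) t :=
  HasFDerivAt.comp_hasDerivAt (f := fun s : ℝ => (x, s)) t (hf.hasFDerivAt hJ x ht)
    (hasDerivAt_prodMk_right x t)

theorem SmoothField.dX_eq (hf : SmoothField J f) (hJ : IsOpen J) (x : ℝ) {t : ℝ} (ht : t ∈ J) :
    dX f x t = fderiv ℝ (Function.uncurry f) (x, t) (1, 0) := (hf.hasDerivAt_fst hJ x ht).deriv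

theorem SmoothField.dT_eq (hf : SmoothField J f) (hJ : IsOpen J) (x : ℝ) {t : ℝ} (ht : t ∈ J) :
    dT f x t = fderiv ℝ (Function.uncurry f) (x, t) (0, 1) := (hf.hasDerivAt_snd hJ x ht).deriv

theorem SmoothField.hasDerivAt_dX (hf : SmoothField J f) (hJ : IsOpen J) (x : ℝ) {t : ℝ}
    (ht : t ∈ J) : HasDerivAt (fun y => f y t) (dX f x t) x :=
  (hf.hasDerivAt_fst hJ x ht).differentiableAt.hasDerivAt

theorem SmoothField.hasDerivAt_dT (hf : SmoothField J f) (hJ : IsOpen J) (x : ℝ) {t : ℝ}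
    (ht : t ∈ J) : HasDerivAt (fun s => f x s) (dT f x t) t :=
  (hf.hasDerivAt_snd hJ x ht).differentiableAt.hasDerivAt

theorem SmoothField.fderiv_apply (hf : SmoothField J f) (hJ : IsOpen J) (w : ℝ × ℝ) :
    ContDiffOn ℝ ∞ (fun p => fderiv ℝ (Function.uncurry f) p w) (Set.univ ×ˢ J) :=
  (ContDiffOn.fderiv_of_isOpen hf (isOpen_univ_prod hJ) (m := ∞) (by simp)).clm_apply
    contDiffOn_const

theorem SmoothField.dX (hf : SmoothField J f) (hJ : IsOpen J) : SmoothField J (dX f) :=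
  (hf.fderiv_apply hJ (1, 0)).congr fun p hp => hf.dX_eq hJ p.1 hp.2

theorem SmoothField.dT (hf : SmoothField J f) (hJ : IsOpen J) : SmoothField J (dT f) :=
  (hf.fderiv_apply hJ (0, 1)).congr fun p hp => hf.dT_eq hJ p.1 hp.2

theorem SmoothField.neg (hf : SmoothField J f) : SmoothField J (-f) := ContDiffOn.neg hf

theorem SmoothField.dT_dX (hf : SmoothField J f) (hJ : IsOpen J) (x : ℝ) {t : ℝ} (ht : t ∈ J) :
    CalogeroMoser2D.dT (CalogeroMoser2D.dX f) x t
      = CalogeroMoser2D.dX (CalogeroMoser2D.dT f) x t := by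
  have hsym : IsSymmSndFDerivAt ℝ (Function.uncurry f) (x, t) :=
    (hf.contDiffAt hJ x ht).isSymmSndFDerivAt (by
      rw [minSmoothness_of_isRCLikeNormedField]; exact WithTop.coe_le_coe.2 le_top)
  have hd : HasFDerivAt (fderiv ℝ (Function.uncurry f))
      (fderiv ℝ (fderiv ℝ (Function.uncurry f)) (x, t)) (x, t) :=
    (((hf.contDiffAt hJ x ht).fderiv_right (m := ∞) (by simp)).differentiableAt
      (by simp)).hasFDerivAt
  have h1 : HasDerivAt (fun s => CalogeroMoser2D.dX f x s)
      (fderiv ℝ (fderiv ℝ (Function.uncurry f)) (x, t) (0, 1) (1, 0)) t := by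
    have := (HasFDerivAt.comp_hasDerivAt (f := fun s : ℝ => (x, s)) t hd
      (hasDerivAt_prodMk_right x t)).clm_apply (hasDerivAt_const t ((1 : ℝ), (0 : ℝ)))
    rw [map_zero, add_zero] at this
    refine this.congr_of_eventuallyEq ?_
    filter_upwards [hJ.mem_nhds ht] with s hs using hf.dX_eq hJ x hs
  have h2 : HasDerivAt (fun y => CalogeroMoser2D.dT f y t)
      (fderiv ℝ (fderiv ℝ (Function.uncurry f)) (x, t) (1, 0) (0, 1)) x := by
    have := (HasFDerivAt.comp_hasDerivAt (f := fun y : ℝ => (y, t)) x hd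
      (hasDerivAt_prodMk_left x t)).clm_apply (hasDerivAt_const x ((0 : ℝ), (1 : ℝ)))
    rw [map_zero, add_zero] at this
    exact this.congr_of_eventuallyEq (.of_forall fun y => hf.dT_eq hJ y ht)
  exact h1.deriv.trans ((hsym _ _).trans h2.deriv.symm)

theorem SmoothField.contDiff_slice (hf : SmoothField J f) {t : ℝ} (ht : t ∈ J) :
    ContDiff ℝ ∞ fun x => f x t :=
  contDiffOn_univ.1 (ContDiffOn.comp hf (by fun_prop : ContDiffOn ℝ ∞ (fun x : ℝ => (x, t)) Set.univ)
    fun _ _ => ⟨trivial, ht⟩)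

theorem dX_periodic {ℓ : ℝ} {t : ℝ} (hper : Function.Periodic (fun x => f x t) ℓ) :
    Function.Periodic (fun x => dX f x t) ℓ := by
  intro x
  have : (fun y => f (y + ℓ) t) = fun y => f y t := funext hper
  change deriv (fun y => f y t) (x + ℓ) = deriv (fun y => f y t) x
  rw [← deriv_comp_add_const, this]

theorem dT_periodic {ℓ : ℝ} (hJ : IsOpen J)
    (hper : ∀ t ∈ J, Function.Periodic (fun x => f x t) ℓ) {t : ℝ} (ht : t ∈ J) :
    Function.Periodic (fun x => dT f x t) ℓ := by
  intro x
  apply Filter.EventuallyEq.deriv_eq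
  filter_upwards [hJ.mem_nhds ht] with s hs using hper s hs x

theorem dX_neg : dX (-f) = -dX f := by
  ext x t; exact deriv.fun_neg

theorem dT_neg : dT (-f) = -dT f := by
  ext x t; exact deriv.fun_neg

end Fields

/-! ### Flux, defects and the explicit equations of motion -/

/-- The standing assumptions on the fields, apart from periodicity. -/
structure FieldData (τ : UpperHalfPlane) (h : ℂ) (J : Set ℝ) (u v ν : ℝ → ℝ → ℂ) : Prop where
  h_ne : h ≠ 0
  isOpen : IsOpen J
  u_smooth : SmoothField J u
  v_smooth : SmoothField J v
  ν_smooth : SmoothField J ν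
  notMem : ∀ x : ℝ, ∀ t ∈ J, 2 * u x t ∉ Λ τ
  ν_ne : ∀ x : ℝ, ∀ t ∈ J, ν x t ≠ 0
  ν_sq : ∀ x : ℝ, ∀ t ∈ J, (ν x t) ^ 2 = h - (dX u x t) ^ 2

/-- The momentum flux `∂F/∂uₓ - ∂ₓ ∂F/∂uₓₓ` of the Hamiltonian density `F`. -/
def flux (τ : UpperHalfPlane) (h : ℂ) (u v ν : ℝ → ℝ → ℂ) (x t : ℝ) : ℂ :=
  1 / (8 * (Real.pi : ℂ) ^ 2 * h) * (v x t) ^ 2 * dX u x t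
    + 6 * dX u x t * wp τ (2 * u x t)
    + (dX (dX (dX u)) x t * ν x t - dX ν x t * dX (dX u) x t) / (2 * (ν x t) ^ 3)

/-- The defect of the equation of motion for `u`. -/
def defectU (h : ℂ) (u v : ℝ → ℝ → ℂ) (x t : ℝ) : ℂ :=
  dT u x t + v x t / (8 * (Real.pi : ℂ) ^ 2) * (1 - (dX u x t) ^ 2 / h)

/-- The defect of the equation of motion for `v`. -/
def defectV (τ : UpperHalfPlane) (h : ℂ) (u v ν : ℝ → ℝ → ℂ) (x t : ℝ) : ℂ :=
  dT v x t - dX (flux τ h u v ν) x t + 2 * (3 * (dX u x t) ^ 2 - h) * wp' τ (2 * u x t)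

namespace FieldData

variable {τ : UpperHalfPlane} {h : ℂ} {J : Set ℝ} {u v ν : ℝ → ℝ → ℂ}

/-- The symmetry (u, v, ν) ↦ (-u, -v, ν) exchanges the off-diagonal entries of L and of M, so the
(2,1) entry of the curvature follows from the (1,2) entry. -/
theorem neg (H : FieldData τ h J u v ν) : FieldData τ h J (-u) (-v) ν where
  h_ne := H.h_ne
  isOpen := H.isOpen
  u_smooth := H.u_smooth.neg
  v_smooth := H.v_smooth.neg
  ν_smooth := H.ν_smooth
  notMem x t ht := by
    have := neg_notMem τ (H.notMem x t ht)
    simpa using this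
  ν_ne := H.ν_ne
  ν_sq x t ht := by rw [dX_neg]; simpa using H.ν_sq x t ht

theorem hasDerivAt_u (H : FieldData τ h J u v ν) (x : ℝ) {t : ℝ} (ht : t ∈ J) :
    HasDerivAt (fun y => u y t) (dX u x t) x := H.u_smooth.hasDerivAt_dX H.isOpen x ht

theorem hasDerivAt_ux (H : FieldData τ h J u v ν) (x : ℝ) {t : ℝ} (ht : t ∈ J) :
    HasDerivAt (fun y => dX u y t) (dX (dX u) x t) x :=
  (H.u_smooth.dX H.isOpen).hasDerivAt_dX H.isOpen x ht

theorem hasDerivAt_uxx (H : FieldData τ h J u v ν) (x : ℝ) {t : ℝ} (ht : t ∈ J) :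
    HasDerivAt (fun y => dX (dX u) y t) (dX (dX (dX u)) x t) x :=
  ((H.u_smooth.dX H.isOpen).dX H.isOpen).hasDerivAt_dX H.isOpen x ht

theorem hasDerivAt_v (H : FieldData τ h J u v ν) (x : ℝ) {t : ℝ} (ht : t ∈ J) :
    HasDerivAt (fun y => v y t) (dX v x t) x := H.v_smooth.hasDerivAt_dX H.isOpen x ht

theorem hasDerivAt_ν (H : FieldData τ h J u v ν) (x : ℝ) {t : ℝ} (ht : t ∈ J) :
    HasDerivAt (fun y => ν y t) (dX ν x t) x := H.ν_smooth.hasDerivAt_dX H.isOpen x ht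

theorem hasDerivAt_ut (H : FieldData τ h J u v ν) (x : ℝ) {t : ℝ} (ht : t ∈ J) :
    HasDerivAt (fun y => dT u y t) (dX (dT u) x t) x :=
  (H.u_smooth.dT H.isOpen).hasDerivAt_dX H.isOpen x ht

theorem dX_ν (H : FieldData τ h J u v ν) (x : ℝ) {t : ℝ} (ht : t ∈ J) :
    dX ν x t = -(dX u x t * dX (dX u) x t) / ν x t := by
  have h1 := (H.hasDerivAt_ν x ht).fun_pow 2
  have h2 := ((H.hasDerivAt_ux x ht).fun_pow 2).const_sub h
  have := h1.unique (h2.congr_of_eventuallyEq (.of_forall fun y => H.ν_sq y t ht))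
  push_cast at this
  rw [eq_div_iff (H.ν_ne x t ht)]
  linear_combination this / 2

theorem dT_ν (H : FieldData τ h J u v ν) (x : ℝ) {t : ℝ} (ht : t ∈ J) :
    dT ν x t = -(dX u x t * dX (dT u) x t) / ν x t := by
  have h1 := (H.ν_smooth.hasDerivAt_dT H.isOpen x ht).fun_pow 2
  have h2 := (((H.u_smooth.dX H.isOpen).hasDerivAt_dT H.isOpen x ht).fun_pow 2).const_sub h
  have := h1.unique (h2.congr_of_eventuallyEq (by
    filter_upwards [H.isOpen.mem_nhds ht] with s hs using H.ν_sq x s hs))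
  rw [H.u_smooth.dT_dX H.isOpen x ht] at this
  push_cast at this
  rw [eq_div_iff (H.ν_ne x t ht)]
  linear_combination this / 2

theorem hasDerivAt_comp_x (H : FieldData τ h J u v ν) {g : ℂ → ℂ} {g' : ℂ} (x : ℝ) {t : ℝ}
    (ht : t ∈ J) (hg : HasDerivAt g g' (2 * u x t)) :
    HasDerivAt (fun y => g (2 * u y t)) (g' * (2 * dX u x t)) x :=
  hg.comp x ((H.hasDerivAt_u x ht).const_mul 2)

theorem hasDerivAt_comp_t (H : FieldData τ h J u v ν) {g : ℂ → ℂ} {g' : ℂ} (x : ℝ) {t : ℝ}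
    (ht : t ∈ J) (hg : HasDerivAt g g' (2 * u x t)) :
    HasDerivAt (fun s => g (2 * u x s)) (g' * (2 * dT u x t)) t :=
  hg.comp t ((H.u_smooth.hasDerivAt_dT H.isOpen x ht).const_mul 2)

theorem contDiff_comp (H : FieldData τ h J u v ν) {g : ℂ → ℂ}
    (hg : AnalyticOnNhd ℂ g (Λ τ : Set ℂ)ᶜ) {t : ℝ} (ht : t ∈ J) :
    ContDiff ℝ ∞ fun x => g (2 * u x t) := by
  have hu := H.u_smooth.contDiff_slice ht
  refine contDiff_iff_contDiffAt.2 fun x => ?_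
  have h1 : ContDiffAt ℝ ∞ g (2 * u x t) :=
    ((hg _ (H.notMem x t ht)).contDiffAt (n := ∞)).restrict_scalars ℝ
  exact ContDiffAt.comp x h1 (contDiff_const.mul hu).contDiffAt

theorem contDiff_flux (H : FieldData τ h J u v ν) {t : ℝ} (ht : t ∈ J) :
    ContDiff ℝ ∞ fun x => flux τ h u v ν x t := by
  have h0 := H.u_smooth.dX H.isOpen
  have h1 := h0.dX H.isOpen
  have h2 := (h1.dX H.isOpen).contDiff_slice ht
  have hν := H.ν_smooth.contDiff_slice ht
  have hνx := (H.ν_smooth.dX H.isOpen).contDiff_slice ht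
  have hw := H.contDiff_comp (analyticOnNhd_wp τ) ht
  have h0 := h0.contDiff_slice ht
  have h1 := h1.contDiff_slice ht
  have hv := H.v_smooth.contDiff_slice ht
  have hnum : ContDiff ℝ ∞ fun x => dX (dX (dX u)) x t * ν x t - dX ν x t * dX (dX u) x t := by
    fun_prop
  have hden : ContDiff ℝ ∞ fun x => 2 * ν x t ^ 3 := by fun_prop
  have hfirst : ContDiff ℝ ∞ fun x => 1 / (8 * (Real.pi : ℂ) ^ 2 * h) * (v x t) ^ 2 * dX u x t
    + 6 * dX u x t * wp τ (2 * u x t) := by fun_prop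
  simp only [flux, div_eq_mul_inv (_ - _)]
  exact hfirst.add (hnum.mul (hden.inv fun x =>
    mul_ne_zero two_ne_zero (pow_ne_zero 3 (H.ν_ne x t ht))))

theorem hasDerivAt_flux (H : FieldData τ h J u v ν) (x : ℝ) {t : ℝ} (ht : t ∈ J) :
    HasDerivAt (fun y => flux τ h u v ν y t) (dX (flux τ h u v ν) x t) x :=
  ((H.contDiff_flux ht).differentiable (by simp) x).hasDerivAt

/-- The right-hand side of the equation of motion for `v`. -/
theorem dX_flux (H : FieldData τ h J u v ν) (x : ℝ) {t : ℝ} (ht : t ∈ J) :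
    dX (flux τ h u v ν) x t =
      1 / (8 * (Real.pi : ℂ) ^ 2 * h) * dX (fun y s => (v y s) ^ 2 * dX u y s) x t
      + 6 * dX (fun y s => dX u y s * wp τ (2 * u y s)) x t
      + 1 / 2 * dX (fun y s =>
          (dX (dX (dX u)) y s * ν y s - dX ν y s * dX (dX u) y s) / (ν y s) ^ 3) x t := by
  have h0 := H.u_smooth.dX H.isOpen
  have h1 := h0.dX H.isOpen
  have h2 := (h1.dX H.isOpen).hasDerivAt_dX H.isOpen x ht
  have hνx := (H.ν_smooth.dX H.isOpen).hasDerivAt_dX H.isOpen x ht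
  have hw := H.hasDerivAt_comp_x x ht (hasDerivAt_wp τ (H.notMem x t ht))
  have h0 := H.hasDerivAt_ux x ht
  have e1 := (((H.hasDerivAt_v x ht).fun_pow 2).mul h0).differentiableAt.hasDerivAt.const_mul
    (1 / (8 * (Real.pi : ℂ) ^ 2 * h))
  have e2 := (h0.mul hw).differentiableAt.hasDerivAt.const_mul 6
  have e3 := (((h2.mul (H.hasDerivAt_ν x ht)).sub (hνx.mul (H.hasDerivAt_uxx x ht))).div
    ((H.hasDerivAt_ν x ht).fun_pow 3)
    (pow_ne_zero 3 (H.ν_ne x t ht))).differentiableAt.hasDerivAt.const_mul (1 / 2)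
  refine (((e1.add e2).add e3).congr_of_eventuallyEq (.of_forall fun y => ?_)).deriv
  simp only [flux, Pi.add_apply, Pi.mul_apply, Pi.div_apply, Pi.sub_apply]
  field_simp

theorem isFieldSolution_iff (H : FieldData τ h J u v ν) :
    IsFieldSolution τ h J u v ν ↔
      ∀ x : ℝ, ∀ t ∈ J, defectU h u v x t = 0 ∧ defectV τ h u v ν x t = 0 := by
  refine forall_congr' fun x => forall_congr' fun t => forall_congr' fun ht => ?_
  rw [defectU, defectV, H.dX_flux x ht]
  refine and_congr ⟨fun e => ?_, fun e => ?_⟩ ⟨fun e => ?_, fun e => ?_⟩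
  · rw [e]; ring
  · linear_combination e
  · rw [e]; ring
  · linear_combination e

end FieldData

/-! ### The Zakharov–Shabat equation -/

theorem M₂₁_eq (τ : UpperHalfPlane) (h : ℂ) (u v ν : ℝ → ℝ → ℂ) (z : ℂ) :
    M₂₁ τ h u v ν z = M₁₂ τ h (-u) (-v) ν z := by
  ext x t
  rw [M₂₁, M₁₂, dX_neg, dX_neg]
  simp only [Pi.neg_apply, mul_neg, neg_mul, neg_neg, neg_div, sub_neg_eq_add]

theorem defectU_neg (h : ℂ) (u v : ℝ → ℝ → ℂ) (x t : ℝ) :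
    defectU h (-u) (-v) x t = -defectU h u v x t := by
  simp only [defectU, dX_neg, dT_neg, Pi.neg_apply, neg_sq]
  ring

theorem dX_defectU_neg (h : ℂ) (u v : ℝ → ℝ → ℂ) (x t : ℝ) :
    dX (defectU h (-u) (-v)) x t = -dX (defectU h u v) x t := by
  rw [show defectU h (-u) (-v) = -defectU h u v from
    funext fun x => funext fun t => defectU_neg h u v x t, dX_neg]
  rfl

namespace FieldData

variable {τ : UpperHalfPlane} {h : ℂ} {J : Set ℝ} {u v ν : ℝ → ℝ → ℂ}

theorem dT_mul_phi (H : FieldData τ h J u v ν) (x : ℝ) {t : ℝ} (ht : t ∈ J) {z : ℂ}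
    (hz : z ∉ Λ τ) :
    dT (fun y s => ν y s * phi τ (2 * u y s) z) x t
      = dT ν x t * phi τ (2 * u x t) z
        + ν x t * (phi' τ (2 * u x t) z * (2 * dT u x t)) :=
  ((H.ν_smooth.hasDerivAt_dT H.isOpen x ht).mul (H.hasDerivAt_comp_t x ht
    (hasDerivAt_phi τ (H.notMem x t ht) hz))).deriv

theorem dX_M₁₂ (H : FieldData τ h J u v ν) (x : ℝ) {t : ℝ} (ht : t ∈ J) {z : ℂ}
    (hz : z ∉ Λ τ) :
    dX (M₁₂ τ h u v ν z) x t
      = -(dX ν x t / (2 * Real.pi * I)) * phi' τ (2 * u x t) z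
        + -(ν x t / (2 * Real.pi * I)) * ((2 * E₁ τ z * phi' τ (2 * u x t) z
          - E₁ τ z ^ 2 * phi τ (2 * u x t) z
          + (2 * wp τ (2 * u x t) + wp τ z) * phi τ (2 * u x t) z) * (2 * dX u x t))
        + ((dX ν x t / (2 * Real.pi * I) * E₁ τ z
          + ((dX v x t * dX u x t + v x t * dX (dX u) x t) * ν x t
            + v x t * dX u x t * dX ν x t) / (8 * (Real.pi : ℂ) ^ 2 * h)
          - 1 / (4 * Real.pi * I) * ((dX (dX (dX u)) x t * ν x t - dX (dX u) x t * dX ν x t)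
            / ν x t ^ 2)) * phi τ (2 * u x t) z
        + (ν x t / (2 * Real.pi * I) * E₁ τ z
          + v x t * dX u x t * ν x t / (8 * (Real.pi : ℂ) ^ 2 * h)
          - 1 / (4 * Real.pi * I) * (dX (dX u) x t / ν x t))
            * (phi' τ (2 * u x t) z * (2 * dX u x t))) := by
  have h0 := H.hasDerivAt_ux x ht
  have h1 := H.hasDerivAt_uxx x ht
  have hv := H.hasDerivAt_v x ht
  have hν := H.hasDerivAt_ν x ht
  have hφ := H.hasDerivAt_comp_x x ht (hasDerivAt_phi τ (H.notMem x t ht) hz)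
  have hφ' := H.hasDerivAt_comp_x x ht (hasDerivAt_phi' τ (H.notMem x t ht) hz)
  exact (((hν.div_const (2 * Real.pi * I)).fun_neg.mul hφ').add
    (((((hν.div_const (2 * Real.pi * I)).mul_const (E₁ τ z)).add
      (((hv.mul h0).mul hν).div_const (8 * (Real.pi : ℂ) ^ 2 * h))).sub
      ((h1.div hν (H.ν_ne x t ht)).const_mul (1 / (4 * Real.pi * I)))).mul hφ)).deriv

theorem dX_defectU (H : FieldData τ h J u v ν) (x : ℝ) {t : ℝ} (ht : t ∈ J) :
    dX (defectU h u v) x t = dX (dT u) x t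
      + (dX v x t / (8 * (Real.pi : ℂ) ^ 2) * (1 - (dX u x t) ^ 2 / h)
        + v x t / (8 * (Real.pi : ℂ) ^ 2) * -(2 * dX u x t * dX (dX u) x t / h)) := by
  have h0 := ((((H.hasDerivAt_ux x ht).fun_pow 2).div_const h).const_sub 1)
  refine ((H.hasDerivAt_ut x ht).add
    (((H.hasDerivAt_v x ht).div_const (8 * (Real.pi : ℂ) ^ 2)).mul h0)).deriv.trans ?_
  push_cast
  rw [pow_one]

/-- No equation of motion is used. The Lamé equation removes φ'', and ν² = h - uₓ² removes the
derivatives of ν. The remaining time derivatives are u_t, from ∂ₜφ and from M₁₁, and u_tx, from ν_t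
= -uₓu_tx/ν; they assemble into `defectU` and its x-derivative. -/
theorem offDiagonal (H : FieldData τ h J u v ν) (x : ℝ) {t : ℝ} (ht : t ∈ J) {z : ℂ}
    (hz : z ∉ Λ τ) :
    dT (fun y s => ν y s * phi τ (2 * u y s) z) x t - dX (M₁₂ τ h u v ν z) x t
      + 2 * (M₁₁ τ h u v ν z x t * (ν x t * phi τ (2 * u x t) z))
      + 2 * (M₁₂ τ h u v ν z x t * (1 / (4 * Real.pi * I) * v x t + dX u x t * E₁ τ z))
      = 2 * ν x t * defectU h u v x t * (phi' τ (2 * u x t) z - E₁ τ z * phi τ (2 * u x t) z)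
        - dX u x t / ν x t * dX (defectU h u v) x t * phi τ (2 * u x t) z := by
  rw [H.dT_mul_phi x ht hz, H.dX_M₁₂ x ht hz, H.dX_defectU x ht, M₁₁, M₁₂, defectU,
    E₂_sub_E₂ τ (H.notMem x t ht) hz, H.dX_ν x ht, H.dT_ν x ht]
  have hν := H.ν_ne x t ht
  have hh := H.h_ne
  -- With k = πi and π² = -k², and h = ν² + uₓ², the claim becomes a rational identity in
  -- independent variables.
  obtain ⟨k, hk⟩ : ∃ k : ℂ, k = Real.pi * I := ⟨_, rfl⟩
  have hk0 : k ≠ 0 := by rw [hk]; simp [Real.pi_ne_zero]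
  have k2 : 2 * (Real.pi : ℂ) * I = 2 * k := by rw [hk]; ring
  have k4 : 4 * (Real.pi : ℂ) * I = 4 * k := by rw [hk]; ring
  have k8 : (Real.pi : ℂ) ^ 2 = -k ^ 2 := by rw [hk, mul_pow, Complex.I_sq]; ring
  have hsq : h = ν x t ^ 2 + dX u x t ^ 2 := by rw [H.ν_sq x t ht]; ring
  rw [k2, k4, k8]
  clear k2 k4 k8 hk
  subst hsq
  generalize dX u x t = ux at *
  generalize ν x t = n at *
  generalize dX (dX u) x t = uxx
  generalize dX (dX (dX u)) x t = uxxx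
  generalize dX (dT u) x t = utx
  generalize dT u x t = ut
  generalize dX v x t = vx
  generalize v x t = v
  generalize phi τ (2 * u x t) z = p
  generalize phi' τ (2 * u x t) z = p'
  generalize wp τ (2 * u x t) = P
  generalize wp τ z = Q
  generalize E₁ τ z = E
  field_simp
  ring

theorem hasDerivAt_M₁₁ (H : FieldData τ h J u v ν) (x : ℝ) {t : ℝ} (ht : t ∈ J) (z : ℂ) :
    HasDerivAt (fun y => M₁₁ τ h u v ν z y t)
      (-dX (dT u) x t * E₁ τ z - 1 / (4 * Real.pi * I) * dX (flux τ h u v ν) x t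
        + (dX (dX u) x t / (2 * Real.pi * I) * (E₂ τ (2 * u x t) - E₂ τ z)
          + dX u x t / (2 * Real.pi * I) * (wp' τ (2 * u x t) * (2 * dX u x t)))) x := by
  have h0 := H.hasDerivAt_ux x ht
  have hE := H.hasDerivAt_comp_x x ht (hasDerivAt_E₂ τ (H.notMem x t ht))
  exact (((H.hasDerivAt_ut x ht).fun_neg.mul_const (E₁ τ z)).sub
    ((H.hasDerivAt_flux x ht).const_mul (1 / (4 * Real.pi * I)))).add
    ((h0.div_const (2 * Real.pi * I)).mul (hE.sub_const (E₂ τ z)))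

theorem hasDerivAt_L₁₁ (H : FieldData τ h J u v ν) (x : ℝ) {t : ℝ} (ht : t ∈ J) (z : ℂ) :
    HasDerivAt (fun s => -(1 / (4 * Real.pi * I)) * v x s - dX u x s * E₁ τ z)
      (-(1 / (4 * Real.pi * I)) * dT v x t - dX (dT u) x t * E₁ τ z) t := by
  rw [← H.u_smooth.dT_dX H.isOpen x ht]
  exact ((H.v_smooth.hasDerivAt_dT H.isOpen x ht).const_mul _).sub
    (((H.u_smooth.dX H.isOpen).hasDerivAt_dT H.isOpen x ht).mul_const _)

/-- In M₁₂L₂₁ - L₁₂M₂₁ the terms common to both brackets cancel. The Wronskian remains with weight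
ν², and φ(2u,z)φ(-2u,z) with weight uₓₓ; the latter cancels uₓₓ(E₂(2u) - E₂(z)) from ∂ₓM₁₁. The
terms in E₁(z) cancel since u_xt = u_tx. -/
theorem diagonal (H : FieldData τ h J u v ν) (x : ℝ) {t : ℝ} (ht : t ∈ J) {z : ℂ}
    (hz : z ∉ Λ τ) :
    dT (fun y s => -(1 / (4 * Real.pi * I)) * v y s - dX u y s * E₁ τ z) x t
      - dX (M₁₁ τ h u v ν z) x t
      + (M₁₂ τ h u v ν z x t * (ν x t * phi τ (-2 * u x t) z)
        - ν x t * phi τ (2 * u x t) z * M₂₁ τ h u v ν z x t)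
      = -(1 / (4 * Real.pi * I)) * defectV τ h u v ν x t := by
  rw [show dT (fun y s => -(1 / (4 * Real.pi * I)) * v y s - dX u y s * E₁ τ z) x t = _ from
    (H.hasDerivAt_L₁₁ x ht z).deriv, show dX (M₁₁ τ h u v ν z) x t = _ from
    (H.hasDerivAt_M₁₁ x ht z).deriv, M₁₂, M₂₁, defectV, E₂_sub_E₂ τ (H.notMem x t ht) hz]
  have hW := phi_wronskian τ (H.notMem x t ht) hz
  have hP := phi_mul_phi_neg τ (H.notMem x t ht) hz
  rw [show -2 * u x t = -(2 * u x t) by ring]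
  have hν := H.ν_ne x t ht
  have hsq := H.ν_sq x t ht
  have e : ν x t * phi τ (2 * u x t) z * (1 / (4 * Real.pi * I) * (dX (dX u) x t / ν x t))
      = phi τ (2 * u x t) z * (1 / (4 * Real.pi * I) * dX (dX u) x t) := by
    field_simp
  have e' : ν x t * phi τ (-(2 * u x t)) z * (1 / (4 * Real.pi * I) * (dX (dX u) x t / ν x t))
      = phi τ (-(2 * u x t)) z * (1 / (4 * Real.pi * I) * dX (dX u) x t) := by
    field_simp
  rw [show (2 * Real.pi * I : ℂ) = (4 * Real.pi * I) / 2 by ring]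
  generalize (4 * Real.pi * I : ℂ) = c at *
  simp only [div_div_eq_mul_div, div_eq_mul_inv _ c, one_mul] at *
  linear_combination (-(ν x t) ^ 2 * 2 * c⁻¹) * hW
    - (dX (dX u) x t * 2 * c⁻¹) * hP + (2 * c⁻¹ * wp' τ (2 * u x t)) * hsq
    - phi τ (-(2 * u x t)) z * e - phi τ (2 * u x t) z * e'

/-- The curvature of the `L`-`M` pair in terms of the defects of the equations of motion. -/
theorem zakharovShabat_eq (H : FieldData τ h J u v ν) (x : ℝ) {t : ℝ} (ht : t ∈ J) {z : ℂ}
    (hz : z ∉ Λ τ) :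
    dTMat (Lmat τ u v ν z) x t - dXMat (Mmat τ h u v ν z) x t
      + (Mmat τ h u v ν z x t * Lmat τ u v ν z x t - Lmat τ u v ν z x t * Mmat τ h u v ν z x t)
    = !![-(1 / (4 * Real.pi * I)) * defectV τ h u v ν x t,
        2 * ν x t * defectU h u v x t * (phi' τ (2 * u x t) z - E₁ τ z * phi τ (2 * u x t) z)
          - dX u x t / ν x t * dX (defectU h u v) x t * phi τ (2 * u x t) z;
        -(2 * ν x t * defectU h u v x t
            * (phi' τ (-2 * u x t) z - E₁ τ z * phi τ (-2 * u x t) z))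
          - dX u x t / ν x t * dX (defectU h u v) x t * phi τ (-2 * u x t) z,
        1 / (4 * Real.pi * I) * defectV τ h u v ν x t] := by
  have hd := H.diagonal x ht hz
  have ho := H.offDiagonal x ht hz
  have ho' := H.neg.offDiagonal x ht hz
  have e2 : ∀ w : ℂ, 2 * -w = -2 * w := fun w => by ring
  have hM : M₁₁ τ h (-u) (-v) ν z x t = -M₁₁ τ h u v ν z x t := by
    simp only [M₁₁, dX_neg, dT_neg, Pi.neg_apply, mul_neg, wp_neg, E₂_neg τ (H.notMem x t ht)]
    ring
  have hL : dT (fun y s => 1 / (4 * Real.pi * I) * v y s + dX u y s * E₁ τ z) x t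
      = -dT (fun y s => -(1 / (4 * Real.pi * I)) * v y s - dX u y s * E₁ τ z) x t := by
    rw [← Pi.neg_apply, ← Pi.neg_apply, ← dT_neg]
    congr 1; ext y s; simp only [Pi.neg_apply]; ring
  have hM' : dX (fun y s => -M₁₁ τ h u v ν z y s) x t = -dX (M₁₁ τ h u v ν z) x t :=
    congrFun (congrFun (dX_neg (f := M₁₁ τ h u v ν z)) x) t
  simp only [← M₂₁_eq, hM, defectU_neg, dX_defectU_neg, dX_neg, Pi.neg_apply, e2] at ho'
  rw [Lmat, Mmat, Matrix.mul_fin_two, Matrix.mul_fin_two]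
  ext i j
  fin_cases i <;> fin_cases j
  · refine Eq.trans ?_ hd
    change dT (fun y s => -(1 / (4 * Real.pi * I)) * v y s - dX u y s * E₁ τ z) x t
      - dX (M₁₁ τ h u v ν z) x t + (_ + _ - (_ + _)) = _
    ring
  · refine Eq.trans ?_ ho
    change dT (fun y s => ν y s * phi τ (2 * u y s) z) x t
      - dX (M₁₂ τ h u v ν z) x t + (_ + _ - (_ + _)) = _
    ring
  · change dT (fun y s => ν y s * phi τ (-2 * u y s) z) x t
      - dX (M₂₁ τ h u v ν z) x t + (_ + _ - (_ + _)) = -(2 * ν x t * defectU h u v x t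
            * (phi' τ (-2 * u x t) z - E₁ τ z * phi τ (-2 * u x t) z))
          - dX u x t / ν x t * dX (defectU h u v) x t * phi τ (-2 * u x t) z
    linear_combination ho'
  · change dT (fun y s => 1 / (4 * Real.pi * I) * v y s + dX u y s * E₁ τ z) x t
      - dX (fun y s => -M₁₁ τ h u v ν z y s) x t + (_ + _ - (_ + _))
      = 1 / (4 * Real.pi * I) * defectV τ h u v ν x t
    rw [hL, hM']
    linear_combination -hd

theorem zakharovShabat_iff (H : FieldData τ h J u v ν) :
    ZakharovShabat τ h J u v ν ↔
      ∀ x : ℝ, ∀ t ∈ J, defectU h u v x t = 0 ∧ defectV τ h u v ν x t = 0 := by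
  constructor
  · intro hZS x t ht
    have hu := H.notMem x t ht
    have hnu := neg_notMem τ hu
    -- Taking z = -2u(x,t) makes φ(2u,z) = 0, so the (1,2) entry loses its term in ∂ₓ`defectU` and
    -- reduces to a nonzero multiple of `defectU`.
    have hmat := (H.zakharovShabat_eq x ht hnu).symm.trans (hZS x t ht _ hnu)
    have h00 := congrFun (congrFun hmat 0) 0
    have h01 := congrFun (congrFun hmat 0) 1
    simp [phi_neg_self, phi'_neg_self_ne_zero τ hu, Real.pi_ne_zero, H.ν_ne x t ht] at h00 h01
    exact ⟨h01, h00⟩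
  · intro hd x t ht z hz
    have hx : dX (defectU h u v) x t = 0 := by
      rw [dX, show (fun y => defectU h u v y t) = fun _ => 0 from funext fun y => (hd y t ht).1,
        deriv_const]
    rw [H.zakharovShabat_eq x ht hz, (hd x t ht).1, (hd x t ht).2, hx]
    ext i j
    fin_cases i <;> fin_cases j <;> simp

end FieldData

/-! ### Variational derivatives -/

/-- Testing against the complex conjugate of g - g' gives ∫ |g - g'|² = 0 over a period; continuity
and periodicity do the rest. -/
theorem HasVariationalDeriv.unique {ℓ : ℝ} (hℓ : 0 < ℓ) {H : (ℝ → ℂ) → ℂ} {g g' a : ℝ → ℂ}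
    (hg : IsLoop ℓ g) (hg' : IsLoop ℓ g') (h : HasVariationalDeriv ℓ H g a)
    (h' : HasVariationalDeriv ℓ H g' a) : g = g' := by
  have hsub : ContDiff ℝ ∞ fun x => g x - g' x := hg.1.sub hg'.1
  have hw : IsLoop ℓ fun x => (starRingEnd ℂ) (g x - g' x) :=
    ⟨Complex.conjCLE.contDiff.comp hsub, fun x => by simp only [hg.2 x, hg'.2 x]⟩
  have hint := (h _ hw).unique (h' _ hw)
  have hc : Continuous fun x => g x - g' x := hsub.continuous
  have hcg := hg.1.continuous
  have hcg' := hg'.1.continuous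
  have hcw := hw.1.continuous
  have i₁ : IntervalIntegrable (fun x => g x * (starRingEnd ℂ) (g x - g' x))
      MeasureTheory.volume 0 ℓ := (hcg.mul hcw).intervalIntegrable _ _
  have i₂ : IntervalIntegrable (fun x => g' x * (starRingEnd ℂ) (g x - g' x))
      MeasureTheory.volume 0 ℓ := (hcg'.mul hcw).intervalIntegrable _ _
  rw [← sub_eq_zero, ← intervalIntegral.integral_sub i₁ i₂] at hint
  have hnorm : ∫ x in (0 : ℝ)..ℓ, Complex.normSq (g x - g' x) = 0 := by
    have e : ∀ x, g x * (starRingEnd ℂ) (g x - g' x) - g' x * (starRingEnd ℂ) (g x - g' x)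
        = (Complex.normSq (g x - g' x) : ℂ) := fun x => by
      rw [← sub_mul, Complex.mul_conj]
    simp only [e] at hint
    rw [intervalIntegral.integral_ofReal] at hint
    exact_mod_cast hint
  have hzero : ∀ x ∈ Set.Icc (0 : ℝ) ℓ, g x - g' x = 0 := by
    by_contra! hcon
    obtain ⟨c, hc0, hcne⟩ := hcon
    exact (intervalIntegral.integral_pos hℓ
      (Complex.continuous_normSq.comp hc).continuousOn (fun x _ => Complex.normSq_nonneg _)
      ⟨c, hc0, Complex.normSq_pos.2 hcne⟩).ne' hnorm
  ext x
  have hper : Function.Periodic (fun x => g x - g' x) ℓ := hg.2.sub hg'.2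
  obtain ⟨y, hy, hxy⟩ := hper.exists_mem_Ico₀ hℓ x
  exact sub_eq_zero.1 (hxy.trans (hzero y ⟨hy.1, hy.2.le⟩))

theorem IsLoop.hasDerivAt {ℓ : ℝ} {w : ℝ → ℂ} (hw : IsLoop ℓ w) (x : ℝ) :
    HasDerivAt w (deriv w x) x :=
  (hw.1.differentiable (by simp) x).hasDerivAt

theorem IsLoop.deriv {ℓ : ℝ} {w : ℝ → ℂ} (hw : IsLoop ℓ w) : IsLoop ℓ (deriv w) :=
  ⟨(contDiff_infty_iff_deriv.1 hw.1).2, fun x => by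
    rw [← deriv_comp_add_const, show (fun y => w (y + ℓ)) = w from funext hw.2]⟩

namespace FieldData

variable {τ : UpperHalfPlane} {h : ℂ} {J : Set ℝ} {u v ν : ℝ → ℝ → ℂ}

/-- Eliminating ν shows that the flux is periodic, although ν is not assumed to be (it may change
sign over a period). -/
theorem flux_eq (H : FieldData τ h J u v ν) (x : ℝ) {t : ℝ} (ht : t ∈ J) :
    flux τ h u v ν x t = 1 / (8 * (Real.pi : ℂ) ^ 2 * h) * (v x t) ^ 2 * dX u x t
      + 6 * dX u x t * wp τ (2 * u x t)
      + dX (dX (dX u)) x t / (2 * (h - dX u x t ^ 2))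
      + dX u x t * dX (dX u) x t ^ 2 / (2 * (h - dX u x t ^ 2) ^ 2) := by
  have hν := H.ν_ne x t ht
  rw [flux, H.dX_ν x ht, ← H.ν_sq x t ht]
  field_simp
  ring

theorem flux_periodic (H : FieldData τ h J u v ν) {ℓ t : ℝ} (ht : t ∈ J)
    (hu : Function.Periodic (fun x => u x t) ℓ) (hv : Function.Periodic (fun x => v x t) ℓ) :
    Function.Periodic (fun x => flux τ h u v ν x t) ℓ := by
  intro x
  have h1 := dX_periodic hu
  have h2 := dX_periodic h1
  have h3 := dX_periodic h2
  simp only [H.flux_eq _ ht]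
  rw [show u (x + ℓ) t = u x t from hu x, show v (x + ℓ) t = v x t from hv x,
    show dX u (x + ℓ) t = dX u x t from h1 x, show dX (dX u) (x + ℓ) t = dX (dX u) x t from h2 x,
    show dX (dX (dX u)) (x + ℓ) t = dX (dX (dX u)) x t from h3 x]

theorem ne_zero (H : FieldData τ h J u v ν) (x : ℝ) {t : ℝ} (ht : t ∈ J) :
    h - dX u x t ^ 2 ≠ 0 := by
  rw [← H.ν_sq x t ht]; exact pow_ne_zero 2 (H.ν_ne x t ht)

/-- The variational derivative `δH₀/δv`. -/
theorem hasVariationalDeriv_v (H : FieldData τ h J u v ν) (ℓ : ℝ) {t : ℝ} (ht : t ∈ J) :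
    HasVariationalDeriv ℓ (fun b => H₀ τ ℓ h (fun x => u x t) b)
      (fun x => -(v x t) / (8 * (Real.pi : ℂ) ^ 2) * (1 - (dX u x t) ^ 2 / h))
      (fun x => v x t) := by
  intro w hw
  have h0 := H.u_smooth.dX H.isOpen
  have h1 := ((h0.dX H.isOpen).contDiff_slice ht).continuous
  have h0 := (h0.contDiff_slice ht).continuous
  have hv := (H.v_smooth.contDiff_slice ht).continuous
  have hwp := (H.contDiff_comp (analyticOnNhd_wp τ) ht).continuous
  have hwc := hw.1.continuous
  have hr : Continuous fun x => (dX (dX u) x t) ^ 2 / (4 * (h - (dX u x t) ^ 2)) :=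
    Continuous.div (by fun_prop) (by fun_prop)
      fun x => mul_ne_zero (by norm_num) (H.ne_zero x ht)
  have key := hasDerivAt_intervalIntegral_of_continuousOn (a := 0) (b := ℓ) (s₀ := 0)
    (F := fun s x => -(v x t + s * w x) ^ 2 / (16 * (Real.pi : ℂ) ^ 2) * (1 - (dX u x t) ^ 2 / h)
      + (3 * (dX u x t) ^ 2 - h) * wp τ (2 * u x t)
      - (dX (dX u) x t) ^ 2 / (4 * (h - (dX u x t) ^ 2)))
    (F' := fun s x => -(2 * (v x t + s * w x) * w x) / (16 * (Real.pi : ℂ) ^ 2)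
      * (1 - (dX u x t) ^ 2 / h))
    isOpen_univ (by simp) (by
      simp only [Function.uncurry_def]
      refine (Continuous.sub ?_ (hr.comp continuous_snd)).continuousOn
      refine Continuous.add (by fun_prop) (Continuous.mul (by fun_prop) (hwp.comp continuous_snd)))
    (by simp only [Function.uncurry_def]; fun_prop)
    (fun s x _ => by
      have hs := ((((((hasDerivAt_id s).mul_const (w x)).const_add (v x t)).fun_pow 2).fun_neg.div_const
        (16 * (Real.pi : ℂ) ^ 2)).mul_const (1 - (dX u x t) ^ 2 / h)).add_const
        ((3 * (dX u x t) ^ 2 - h) * wp τ (2 * u x t)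
          - (dX (dX u) x t) ^ 2 / (4 * (h - (dX u x t) ^ 2)))
      simp only [id, add_sub_assoc] at hs ⊢
      refine hs.congr_deriv ?_
      push_cast; ring)
  refine key.congr_deriv ?_
  congr 1; ext x
  ring

/-- The variational derivative `δH₀/δu`. -/
theorem hasVariationalDeriv_u (H : FieldData τ h J u v ν) {ℓ t : ℝ} (ht : t ∈ J)
    (hu : Function.Periodic (fun x => u x t) ℓ) (hv : Function.Periodic (fun x => v x t) ℓ) :
    HasVariationalDeriv ℓ (fun a => H₀ τ ℓ h a (fun x => v x t))
      (fun x => 2 * (3 * (dX u x t) ^ 2 - h) * wp' τ (2 * u x t) - dX (flux τ h u v ν) x t)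
      (fun x => u x t) := by
  intro w hw
  have sx := H.u_smooth.dX H.isOpen
  have cxx := ((sx.dX H.isOpen).contDiff_slice ht).continuous
  have cx := (sx.contDiff_slice ht).continuous
  have cu := (H.u_smooth.contDiff_slice ht).continuous
  have cv := (H.v_smooth.contDiff_slice ht).continuous
  have cw := hw.1.continuous
  have cw1 := hw.deriv.1.continuous
  have cw2 := hw.deriv.deriv.1.continuous
  -- The pairs (s, x) at which the integrand of the varied Hamiltonian stays regular; the set is
  -- open and contains all points with s = 0.
  set U : Set (ℂ × ℝ) := {p | 2 * (u p.2 t + p.1 * w p.2) ∈ (Λ τ : Set ℂ)ᶜ ∧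
    h - (dX u p.2 t + p.1 * deriv w p.2) ^ 2 ≠ 0} with hU
  have hUo : IsOpen U := ((isOpen_compl_Λ τ).preimage (by fun_prop)).inter
    (isOpen_ne_fun (by fun_prop) continuous_const)
  have cinner : Continuous fun p : ℂ × ℝ => 2 * (u p.2 t + p.1 * w p.2) := by fun_prop
  have cwp : ContinuousOn (fun p : ℂ × ℝ => wp τ (2 * (u p.2 t + p.1 * w p.2))) U :=
    (analyticOnNhd_wp τ).continuousOn.comp cinner.continuousOn fun p hp => hp.1
  have cwp' : ContinuousOn (fun p : ℂ × ℝ => wp' τ (2 * (u p.2 t + p.1 * w p.2))) U :=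
    (analyticOnNhd_wp' τ).continuousOn.comp cinner.continuousOn fun p hp => hp.1
  have key := hasDerivAt_intervalIntegral_of_continuousOn (a := 0) (b := ℓ) (s₀ := 0)
    (F := fun s x => -(v x t) ^ 2 / (16 * (Real.pi : ℂ) ^ 2)
        * (1 - (dX u x t + s * deriv w x) ^ 2 / h)
      + (3 * (dX u x t + s * deriv w x) ^ 2 - h) * wp τ (2 * (u x t + s * w x))
      - (dX (dX u) x t + s * deriv (deriv w) x) ^ 2
        / (4 * (h - (dX u x t + s * deriv w x) ^ 2)))
    (F' := fun s x => -(v x t) ^ 2 / (16 * (Real.pi : ℂ) ^ 2)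
        * -(2 * (dX u x t + s * deriv w x) * deriv w x / h)
      + (3 * (2 * (dX u x t + s * deriv w x) * deriv w x) * wp τ (2 * (u x t + s * w x))
        + (3 * (dX u x t + s * deriv w x) ^ 2 - h)
          * (wp' τ (2 * (u x t + s * w x)) * (2 * w x)))
      - (2 * (dX (dX u) x t + s * deriv (deriv w) x) * deriv (deriv w) x
          * (4 * (h - (dX u x t + s * deriv w x) ^ 2))
        - (dX (dX u) x t + s * deriv (deriv w) x) ^ 2
          * (4 * -(2 * (dX u x t + s * deriv w x) * deriv w x)))
        / (4 * (h - (dX u x t + s * deriv w x) ^ 2)) ^ 2)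
    hUo (fun x _ => by simpa [hU] using ⟨H.notMem x t ht, H.ne_zero x ht⟩)
    (by
      simp only [Function.uncurry_def]
      refine ContinuousOn.sub (ContinuousOn.add (Continuous.continuousOn (by fun_prop))
        (ContinuousOn.mul (Continuous.continuousOn (by fun_prop)) cwp))
        (ContinuousOn.div (Continuous.continuousOn (by fun_prop))
        (Continuous.continuousOn (by fun_prop)) fun p hp => ?_)
      exact mul_ne_zero (by norm_num) hp.2)
    (by
      simp only [Function.uncurry_def]
      refine ContinuousOn.sub (ContinuousOn.add (Continuous.continuousOn (by fun_prop))
        (ContinuousOn.add (ContinuousOn.mul (Continuous.continuousOn (by fun_prop)) cwp)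
          (ContinuousOn.mul (Continuous.continuousOn (by fun_prop))
            (ContinuousOn.mul cwp' (Continuous.continuousOn (by fun_prop))))))
        (ContinuousOn.div (Continuous.continuousOn (by fun_prop))
        (Continuous.continuousOn (by fun_prop)) fun p hp => ?_)
      exact pow_ne_zero 2 (mul_ne_zero (by norm_num) hp.2))
    (fun s x hs => by
      have l0 : HasDerivAt (fun s => 2 * (u x t + s * w x)) (2 * w x) s := by
        simpa using (((hasDerivAt_id s).mul_const (w x)).const_add (u x t)).const_mul 2
      have l1 : HasDerivAt (fun s => (dX u x t + s * deriv w x) ^ 2)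
          (2 * (dX u x t + s * deriv w x) * deriv w x) s := by
        simpa using (((hasDerivAt_id s).mul_const (deriv w x)).const_add (dX u x t)).fun_pow 2
      have l2 : HasDerivAt (fun s => (dX (dX u) x t + s * deriv (deriv w) x) ^ 2)
          (2 * (dX (dX u) x t + s * deriv (deriv w) x) * deriv (deriv w) x) s := by
        simpa using (((hasDerivAt_id s).mul_const (deriv (deriv w) x)).const_add
          (dX (dX u) x t)).fun_pow 2
      have lw : HasDerivAt (fun s => wp τ (2 * (u x t + s * w x)))
          (wp' τ (2 * (u x t + s * w x)) * (2 * w x)) s := (hasDerivAt_wp τ hs.1).comp s l0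
      exact ((((l1.div_const h).const_sub 1).const_mul _).add
        (((l1.const_mul 3).sub_const h).mul lw)).sub
        (l2.div ((l1.const_sub h).const_mul 4) (mul_ne_zero (by norm_num) hs.2)))
  have hH : (fun s : ℂ => H₀ τ ℓ h (fun x => u x t + s * w x) (fun x => v x t)) = fun s =>
      ∫ x in (0 : ℝ)..ℓ, (-(v x t) ^ 2 / (16 * (Real.pi : ℂ) ^ 2)
        * (1 - (dX u x t + s * deriv w x) ^ 2 / h)
      + (3 * (dX u x t + s * deriv w x) ^ 2 - h) * wp τ (2 * (u x t + s * w x))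
      - (dX (dX u) x t + s * deriv (deriv w) x) ^ 2
        / (4 * (h - (dX u x t + s * deriv w x) ^ 2))) := by
    ext s
    have d1 : deriv (fun x => u x t + s * w x) = fun x => dX u x t + s * deriv w x :=
      funext fun x => ((H.hasDerivAt_u x ht).add ((hw.hasDerivAt x).const_mul s)).deriv
    have d2 : deriv (fun x => dX u x t + s * deriv w x)
        = fun x => dX (dX u) x t + s * deriv (deriv w) x :=
      funext fun x => ((H.hasDerivAt_ux x ht).add ((hw.deriv.hasDerivAt x).const_mul s)).deriv
    rw [H₀, d1, d2]
  rw [hH]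
  refine key.congr_deriv ?_
  -- Integration by parts: with F the Hamiltonian density, the first variation is (∂F/∂u - ∂ₓ flux)
  -- w + ∂ₓQ, where Q = flux · w + (∂F/∂uₓₓ) wₓ and ∂F/∂uₓₓ = -uₓₓ/(2(h - uₓ²)). As Q is periodic,
  -- its derivative integrates to zero.
  have sQ : ContDiff ℝ ∞ fun x => flux τ h u v ν x t * w x
      - dX (dX u) x t * (2 * (h - dX u x t ^ 2))⁻¹ * deriv w x := by
    have s0 := sx.contDiff_slice ht
    have s1 := (sx.dX H.isOpen).contDiff_slice ht
    have sden : ContDiff ℝ ∞ fun x => 2 * (h - dX u x t ^ 2) := by fun_prop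
    exact ((H.contDiff_flux ht).mul hw.1).sub ((s1.mul (sden.inv fun x =>
      mul_ne_zero two_ne_zero (H.ne_zero x ht))).mul hw.deriv.1)
  have pQ : Function.Periodic (fun x => flux τ h u v ν x t * w x
      - dX (dX u) x t * (2 * (h - dX u x t ^ 2))⁻¹ * deriv w x) ℓ := by
    intro x
    have p1 : dX u (x + ℓ) t = dX u x t := dX_periodic hu x
    have p2 : dX (dX u) (x + ℓ) t = dX (dX u) x t := dX_periodic (dX_periodic hu) x
    have p3 : flux τ h u v ν (x + ℓ) t = flux τ h u v ν x t := H.flux_periodic ht hu hv x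
    simp only [p1, p2, p3, hw.2 x, hw.deriv.2 x]
  generalize hQdef : (fun x => flux τ h u v ν x t * w x
      - dX (dX u) x t * (2 * (h - dX u x t ^ 2))⁻¹ * deriv w x) = Q at sQ pQ
  have hg : Continuous fun x =>
      (2 * (3 * (dX u x t) ^ 2 - h) * wp' τ (2 * u x t) - dX (flux τ h u v ν) x t) * w x := by
    have c1 := (H.contDiff_comp (analyticOnNhd_wp' τ) ht).continuous
    have c2 : Continuous fun x => dX (flux τ h u v ν) x t :=
      (H.contDiff_flux ht).continuous_deriv (by simp)
    fun_prop
  have hQ : ∫ x in (0 : ℝ)..ℓ, deriv Q x = 0 := by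
    rw [intervalIntegral.integral_deriv_eq_sub (fun x _ => sQ.differentiable (by simp) x)
      ((sQ.continuous_deriv (by simp)).intervalIntegrable _ _), ← zero_add ℓ, pQ 0, sub_self]
  have hadd := intervalIntegral.integral_add (μ := MeasureTheory.volume)
    (hg.intervalIntegrable 0 ℓ) ((sQ.continuous_deriv (by simp)).intervalIntegrable 0 ℓ)
  rw [hQ, add_zero] at hadd
  rw [← hadd]
  congr 1; ext x
  have hne := H.ne_zero x ht
  have dQ := ((H.hasDerivAt_flux x ht).mul (hw.hasDerivAt x)).sub
    (((H.hasDerivAt_uxx x ht).mul (((((H.hasDerivAt_ux x ht).fun_pow 2).const_sub h).const_mul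
      2).inv (mul_ne_zero two_ne_zero hne))).mul (hw.deriv.hasDerivAt x))
  rw [← hQdef]
  refine Eq.trans ?_ (congrArg₂ (· + ·) rfl dQ.deriv.symm)
  have hh := H.h_ne
  have hpi : (Real.pi : ℂ) ≠ 0 := by simp [Real.pi_ne_zero]
  simp only [zero_mul, add_zero, Pi.mul_apply, Pi.inv_apply, H.flux_eq x ht]
  generalize hs : h - dX u x t ^ 2 = n at *
  field_simp
  ring

end FieldData

/-! ### The equations of motion -/

theorem hasDerivAt_congr_iff {f : ℂ → ℂ} {d d₀ x : ℂ} (h : HasDerivAt f d₀ x) :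
    HasDerivAt f d x ↔ d = d₀ :=
  ⟨fun h' => h'.unique h, fun e => e ▸ h⟩

theorem cmHamiltonian_two (τ : UpperHalfPlane) (g : ℂ) (p q : Fin 2 → ℂ) :
    cmHamiltonian τ 2 g p q = 1 / 2 * (p 0 ^ 2 + p 1 ^ 2) + g ^ 2 * wp τ (q 1 - q 0) := by
  simp [cmHamiltonian, Finset.sum_filter, Fin.sum_univ_two]

/-! ### Partial derivatives of the two-body Hamiltonian -/

section TwoBody

variable (τ : UpperHalfPlane) (g a b c d : ℂ)

theorem update_zero (y : ℂ) : Function.update ![a, b] 0 y = ![y, b] := by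
  ext i; fin_cases i <;> simp

theorem update_one (y : ℂ) : Function.update ![a, b] 1 y = ![a, y] := by
  ext i; fin_cases i <;> simp

theorem hasDerivAt_cmHamiltonian_p₀ :
    HasDerivAt (fun y => cmHamiltonian τ 2 g (Function.update ![a, b] 0 y) ![c, d]) a a := by
  simp only [cmHamiltonian_two, update_zero, Matrix.cons_val_zero, Matrix.cons_val_one]
  refine (((((hasDerivAt_id a).fun_pow 2).add_const (b ^ 2)).const_mul (1 / 2)).add_const
    (g ^ 2 * wp τ (d - c))).congr_deriv ?_
  simp

theorem hasDerivAt_cmHamiltonian_p₁ :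
    HasDerivAt (fun y => cmHamiltonian τ 2 g (Function.update ![a, b] 1 y) ![c, d]) b b := by
  simp only [cmHamiltonian_two, update_one, Matrix.cons_val_zero, Matrix.cons_val_one]
  refine (((((hasDerivAt_id b).fun_pow 2).const_add (a ^ 2)).const_mul (1 / 2)).add_const
    (g ^ 2 * wp τ (d - c))).congr_deriv ?_
  simp

variable {c d}

theorem hasDerivAt_cmHamiltonian_q₀ (h : d - c ∉ Λ τ) :
    HasDerivAt (fun y => cmHamiltonian τ 2 g ![a, b] (Function.update ![c, d] 0 y))
      (-(g ^ 2 * wp' τ (d - c))) c := by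
  simp only [cmHamiltonian_two, update_zero, Matrix.cons_val_zero, Matrix.cons_val_one]
  refine ((((hasDerivAt_wp τ h).comp_const_sub d c).const_mul (g ^ 2)).const_add
    (1 / 2 * (a ^ 2 + b ^ 2))).congr_deriv ?_
  ring

theorem hasDerivAt_cmHamiltonian_q₁ (h : d - c ∉ Λ τ) :
    HasDerivAt (fun y => cmHamiltonian τ 2 g ![a, b] (Function.update ![c, d] 1 y))
      (g ^ 2 * wp' τ (d - c)) d := by
  simp only [cmHamiltonian_two, update_one, Matrix.cons_val_zero, Matrix.cons_val_one]
  exact (((hasDerivAt_wp τ h).comp_sub_const d c).const_mul (g ^ 2)).const_add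
    (1 / 2 * (a ^ 2 + b ^ 2))

end TwoBody

namespace FieldData

variable {τ : UpperHalfPlane} {h : ℂ} {J : Set ℝ} {u v ν : ℝ → ℝ → ℂ}

theorem isHamiltonianFlow_iff (H : FieldData τ h J u v ν) {ℓ : ℝ} (hℓ : 0 < ℓ)
    (hu : ∀ t ∈ J, Function.Periodic (fun x => u x t) ℓ)
    (hv : ∀ t ∈ J, Function.Periodic (fun x => v x t) ℓ) :
    IsHamiltonianFlow τ ℓ h J u v ↔
      ∀ x : ℝ, ∀ t ∈ J, defectU h u v x t = 0 ∧ defectV τ h u v ν x t = 0 := by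
  have sx := H.u_smooth.dX H.isOpen
  rw [forall_comm]
  refine forall_congr' fun t => ?_
  rw [forall_comm]
  refine forall_congr' fun ht => ?_
  have hdv := H.hasVariationalDeriv_v ℓ ht
  have hdu := H.hasVariationalDeriv_u ht (hu t ht) (hv t ht)
  have px := dX_periodic (hu t ht)
  have cx := sx.contDiff_slice ht
  have cu := H.u_smooth.contDiff_slice ht
  have cv := H.v_smooth.contDiff_slice ht
  constructor
  · rintro ⟨h1, h2⟩ x
    have ct := (H.u_smooth.dT H.isOpen).contDiff_slice ht
    have cvt := (H.v_smooth.dT H.isOpen).contDiff_slice ht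
    have e1 := HasVariationalDeriv.unique hℓ ⟨ct, dT_periodic H.isOpen hu ht⟩
      ⟨by fun_prop, fun x => by
        rw [show v (x + ℓ) t = v x t from hv t ht x, show dX u (x + ℓ) t = dX u x t from px x]⟩
      h1 hdv
    have cf : ContDiff ℝ ∞ fun x => dX (flux τ h u v ν) x t :=
      (contDiff_infty_iff_deriv.1 (H.contDiff_flux ht)).2
    have cwp' := H.contDiff_comp (analyticOnNhd_wp' τ) ht
    have e2 := HasVariationalDeriv.unique hℓ
      ⟨cvt.neg, fun x => by
        rw [show dT v (x + ℓ) t = dT v x t from dT_periodic H.isOpen hv ht x]⟩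
      ⟨by fun_prop, fun x => by
        rw [show u (x + ℓ) t = u x t from hu t ht x, show dX u (x + ℓ) t = dX u x t from px x,
          show dX (flux τ h u v ν) (x + ℓ) t = dX (flux τ h u v ν) x t from
            dX_periodic (H.flux_periodic ht (hu t ht) (hv t ht)) x]⟩
      h2 hdu
    have e1 := congrFun e1 x
    have e2 := congrFun e2 x
    rw [defectU, defectV, e1]
    exact ⟨by ring, by linear_combination -e2⟩
  · intro hd
    constructor
    · convert hdv using 1
      ext x
      have := (hd x).1
      rw [defectU] at this
      linear_combination this
    · convert hdu using 1
      ext x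
      have := (hd x).2
      rw [defectV] at this
      linear_combination -this

/-- For fields that do not depend on `x`, the equations of motion are those of the two-body
elliptic Calogero–Moser system. -/
theorem isCMSolution_iff (H : FieldData τ h J u v ν)
    (hconst : ∀ x : ℝ, ∀ t ∈ J, u x t = u 0 t ∧ v x t = v 0 t) {ν₀ : ℂ} (hν₀ : ν₀ ^ 2 = h) :
    IsCMSolution τ 2 (ν₀ / (2 * Real.pi)) J
        (fun t => ![-(v 0 t) / (8 * (Real.pi : ℂ) ^ 2), v 0 t / (8 * (Real.pi : ℂ) ^ 2)])
        (fun t => ![u 0 t, -(u 0 t)]) ↔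
      ∀ x : ℝ, ∀ t ∈ J, defectU h u v x t = 0 ∧ defectV τ h u v ν x t = 0 := by
  have hpi : (Real.pi : ℂ) ≠ 0 := by simp [Real.pi_ne_zero]
  have hux : ∀ x, ∀ t ∈ J, dX u x t = 0 := fun x t ht => by
    rw [dX, show (fun y => u y t) = fun _ => u 0 t from funext fun y => (hconst y t ht).1,
      deriv_const]
  have huxx : ∀ x, ∀ t ∈ J, dX (dX u) x t = 0 := fun x t ht => by
    rw [dX, show (fun y => dX u y t) = fun _ => 0 from funext fun y => hux y t ht, deriv_const]
  have huxxx : ∀ x, ∀ t ∈ J, dX (dX (dX u)) x t = 0 := fun x t ht => by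
    rw [dX, show (fun y => dX (dX u) y t) = fun _ => 0 from funext fun y => huxx y t ht,
      deriv_const]
  have hflux : ∀ x, ∀ t ∈ J, dX (flux τ h u v ν) x t = 0 := fun x t ht => by
    rw [dX, show (fun y => flux τ h u v ν y t) = fun _ => 0 from
      funext fun y => by simp [flux, hux y t ht, huxx y t ht, huxxx y t ht], deriv_const]
  have hut : ∀ x, ∀ t ∈ J, dT u x t = dT u 0 t := fun x t ht =>
    Filter.EventuallyEq.deriv_eq (by
      filter_upwards [H.isOpen.mem_nhds ht] with s hs using (hconst x s hs).1)
  have hvt : ∀ x, ∀ t ∈ J, dT v x t = dT v 0 t := fun x t ht =>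
    Filter.EventuallyEq.deriv_eq (by
      filter_upwards [H.isOpen.mem_nhds ht] with s hs using (hconst x s hs).2)
  have hdef : ∀ t ∈ J, (∀ x, defectU h u v x t = 0 ∧ defectV τ h u v ν x t = 0) ↔
      dT u 0 t = -(v 0 t) / (8 * (Real.pi : ℂ) ^ 2) ∧
        dT v 0 t = 2 * h * wp' τ (2 * u 0 t) := by
    intro t ht
    have e : ∀ x, defectU h u v x t = dT u 0 t - -(v 0 t) / (8 * (Real.pi : ℂ) ^ 2) ∧
        defectV τ h u v ν x t = dT v 0 t - 2 * h * wp' τ (2 * u 0 t) := fun x => by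
      rw [defectU, defectV, hflux x t ht, hux x t ht, hut x t ht, hvt x t ht, (hconst x t ht).1,
        (hconst x t ht).2]
      exact ⟨by ring, by ring⟩
    simp only [(e _).1, (e _).2, sub_eq_zero, forall_const]
  rw [forall_comm]
  refine forall_congr' fun t => ?_
  rw [forall_comm (α := ℝ)]
  refine forall_congr' fun ht => ?_
  rw [hdef t ht]
  have hu := H.notMem 0 t ht
  have hdu := H.u_smooth.hasDerivAt_dT H.isOpen 0 ht
  have hdv := H.v_smooth.hasDerivAt_dT H.isOpen 0 ht
  have q0 : deriv (fun s => u 0 s) t = dT u 0 t := rfl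
  have q1 : deriv (fun s => -u 0 s) t = -dT u 0 t := hdu.fun_neg.deriv
  have p0 : deriv (fun s => -(v 0 s) / (8 * (Real.pi : ℂ) ^ 2)) t
      = -(dT v 0 t) / (8 * (Real.pi : ℂ) ^ 2) := (hdv.fun_neg.div_const _).deriv
  have p1 : deriv (fun s => v 0 s / (8 * (Real.pi : ℂ) ^ 2)) t
      = dT v 0 t / (8 * (Real.pi : ℂ) ^ 2) := (hdv.div_const _).deriv
  -- The sum over k < j keeps only the pair with argument q₁ - q₀ = -2u, so the oddness of ℘'
  -- supplies a sign.
  have hdiff : -(u 0 t) - u 0 t = -(2 * u 0 t) := by ring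
  have hm : -(u 0 t) - u 0 t ∉ Λ τ := hdiff ▸ neg_notMem τ hu
  have hg : (ν₀ / (2 * Real.pi)) ^ 2 = h / (4 * (Real.pi : ℂ) ^ 2) := by
    rw [div_pow, hν₀]; ring
  simp only [Fin.forall_fin_two, Fin.sum_univ_two, Matrix.cons_val_zero, Matrix.cons_val_one]
  rw [hasDerivAt_congr_iff (hasDerivAt_cmHamiltonian_p₀ τ _ _ _ _ _),
    hasDerivAt_congr_iff (hasDerivAt_cmHamiltonian_p₁ τ _ _ _ _ _),
    hasDerivAt_congr_iff (hasDerivAt_cmHamiltonian_q₀ τ _ _ _ hm),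
    hasDerivAt_congr_iff (hasDerivAt_cmHamiltonian_q₁ τ _ _ _ hm),
    q0, q1, p0, p1, hdiff, wp'_neg τ hu, hg]
  constructor
  · rintro ⟨-, -, ⟨h1, h2⟩, -⟩
    refine ⟨h1, ?_⟩
    field_simp at h2
    linear_combination h2 / 4
  · rintro ⟨h1, h2⟩
    rw [h1, h2]
    refine ⟨by ring, by ring, ⟨rfl, ?_⟩, by ring, ?_⟩
    all_goals
      field_simp
      ring

end FieldData

end CalogeroMoser2D

end
-- The main theorem
open CalogeroMoser2D in
theorem mainTheorem8 (τ : UpperHalfPlane) (ℓ : ℝ) (hℓ : 0 < ℓ) (h : ℂ) (hh : h ≠ 0)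
    (J : Set ℝ) (hJ : IsOpen J) (u v ν : ℝ → ℝ → ℂ)
    (hu : SmoothField J u) (hv : SmoothField J v) (hν : SmoothField J ν)
    (hu_per : ∀ t ∈ J, Function.Periodic (fun x => u x t) ℓ)
    (hv_per : ∀ t ∈ J, Function.Periodic (fun x => v x t) ℓ)
    (hu_lat : ∀ x : ℝ, ∀ t ∈ J, 2 * u x t ∉ Λ τ)
    (hν_ne : ∀ x : ℝ, ∀ t ∈ J, ν x t ≠ 0)
    (hν_sq : ∀ x : ℝ, ∀ t ∈ J, (ν x t) ^ 2 = h - (dX u x t) ^ 2) :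
    (IsHamiltonianFlow τ ℓ h J u v ↔ IsFieldSolution τ h J u v ν) ∧
    (IsHamiltonianFlow τ ℓ h J u v ↔ ZakharovShabat τ h J u v ν) ∧
    ((∀ x : ℝ, ∀ t ∈ J, u x t = u 0 t ∧ v x t = v 0 t) →
      ∀ ν₀ : ℂ, ν₀ ^ 2 = h →
        (IsHamiltonianFlow τ ℓ h J u v ↔
          IsCMSolution τ 2 (ν₀ / (2 * Real.pi)) J
            (fun t => ![-(v 0 t) / (8 * (Real.pi : ℂ) ^ 2), v 0 t / (8 * (Real.pi : ℂ) ^ 2)])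
            (fun t => ![u 0 t, -(u 0 t)]))) := by
  have H : FieldData τ h J u v ν := ⟨hh, hJ, hu, hv, hν, hu_lat, hν_ne, hν_sq⟩
  have hflow := H.isHamiltonianFlow_iff hℓ hu_per hv_per
  exact ⟨hflow.trans H.isFieldSolution_iff.symm, hflow.trans H.zakharovShabat_iff.symm,
    fun hconst ν₀ hν₀ => hflow.trans (H.isCMSolution_iff hconst hν₀).symm⟩
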